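/- Theorem 1.2. Let $k$ be a field, $\Gamma$ a finite group, $A$ a $\Gamma$-algebra, i.e. an associative unital $k$-algebra on which $\Gamma$ acts by $k$-algebra automorphisms $a\mapsto{}^{\sigma}a$, and $M$ a $\Gamma$-equivariant $(A,A)$-bimodule, i.e. a bimodule on which $k$ acts centrally, with a $k$-linear action of $\Gamma$ such that ${}^{\sigma}(am)={}^{\sigma}a\,{}^{\sigma}m$ and ${}^{\sigma}(ma)={}^{\sigma}m\,{}^{\sigma}a$. Tensor products are over $k$. Notation. Let $C^n(A,M)=\operatorname{Hom}_k(A^{\otimes n},M)$ be the Hochschild cochain complex, with differential $$\delta\varphi(a_1,\dots,a_{n+1})=a_1\varphi(a_2,\dots,a_{n+1})+\sum_{j=1}^{n}(-1)^j\varphi(a_1,\dots,a_ja_{j+1},\dots,a_{n+1})+(-1)^{n+1}\varphi(a_1,\dots,a_n)a_{n+1},$$ and let $C^n_\Gamma(A,M)$ be the subcomplex of the $\varphi$ with $\varphi({}^{\sigma}a_1,\dots,{}^{\sigma}a_n)={}^{\sigma}(\varphi(a_1,\dots,a_n))$ for all $\sigma\in\Gamma$; put $\operatorname{HH}^n_\Gamma(A,M)=\operatorname{H}^n(C^*_\Gamma(A,M))$.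 Let $(A,\Gamma)^e$ be the algebra $A\otimes k\Gamma\otimes A$ with $(a\otimes\sigma\otimes b)(c\otimes\tau\otimes d)=a({}^{\sigma}c)\otimes\sigma\tau\otimes({}^{\sigma}d)b$. It acts on $A$ and on $M$ by $(a\otimes\sigma\otimes b)m=a({}^{\sigma}m)b$, and $k\Gamma$ denotes its subalgebra spanned by the $1\otimes\sigma\otimes1$. For a $k$-algebra $R$ with a subalgebra $B$, an exact sequence of $R$-modules is $(R,B)$-exact if the kernels of its maps are direct summands as $B$-modules; an $R$-module is $(R,B)$-projective if maps out of it lift along the surjection of every $(R,B)$-exact sequence $0\to K\to L\to N\to0$; and $\operatorname{Ext}^n_{R,B}(X,N)=\operatorname{H}^n(\operatorname{Hom}_R(P_*,N))$ for an $(R,B)$-exact resolution $P_*\to X$ by $(R,B)$-projective modules. Let $\operatorname{H}^n_\Gamma(A,M)$ be the Koam–Pirashvili equivariant Hochschild cohomology, i.e. the cohomology of the total complex (differential $d_\Gamma+(-1)^p\delta$) of the bicomplex $C^{p,q}=\operatorname{Maps}(\Gamma^p,C^q(A,M))$, $p,q\ge0$, where $d_\Gamma$ is the inhomogeneous group cochain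 differential of $\Gamma$ with coefficients in $C^q(A,M)$, on which $\Gamma$ acts by ${}^{\sigma}\varphi(a_1,\dots,a_q)={}^{\sigma}(\varphi({}^{\sigma^{-1}}a_1,\dots,{}^{\sigma^{-1}}a_q))$, and $\delta$ is the Hochschild differential. Then for every $n\ge0$: (i) With $A^e=A\otimes A^{op}$ and ${}^{\sigma}(a\otimes b)={}^{\sigma}a\otimes{}^{\sigma}b$, the map $a\otimes\sigma\otimes b\mapsto(a\otimes b)\star\sigma$ is an isomorphism of algebras from $(A,\Gamma)^e$ to the skew group algebra $A^e\star\Gamma$. A relative $k\Gamma$-projective resolution of the $(A,\Gamma)^e$-module $A$ exists, and for $\operatorname{Ext}$ computed with any such resolution there is a $k$-linear isomorphism $$\operatorname{HH}^n_\Gamma(A,M)\cong\operatorname{Ext}^n_{(A,\Gamma)^e,\,k\Gamma}(A,M).$$ (ii) The inclusion of $C^*_\Gamma(A,M)$ into the column $p=0$ of the bicomplex induces a $k$-linear map $\operatorname{HH}^n_\Gamma(A,M)\to\operatorname{H}^n_\Gamma(A,M)$. It is natural with respect to the morphisms $(A,M)\to(A',M')$ that consist of a $\Gamma$-equivariant algebra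 homomorphism $A'\to A$ and a $\Gamma$-equivariant homomorphism $M\to M'$ of $A'$-bimodules; in particular it is natural in $M$. It is an isomorphism if $k\Gamma$ is a separable $k$-algebra, i.e. if there is $e=\sum_i x_i\otimes y_i\in k\Gamma\otimes k\Gamma$ with $\sum_i x_iy_i=1$ and $\sum_i bx_i\otimes y_i=\sum_i x_i\otimes y_ib$ for all $b\in k\Gamma$. -/

import Mathlib

open scoped TensorProduct
open MulOpposite

set_option linter.unusedSectionVars false

universe u uR uX uG uA uM uA' uM' v w

noncomputable section

/-! ### Cohomology of a sequence of linear maps -/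

section Cohomology

variable {k : Type u} [Field k]

/-- The coboundaries in degree `n` of a sequence `X 0 ⟶ X 1 ⟶ X 2 ⟶ ⋯` of linear maps:
the zero space for `n = 0` and the image of `d (n - 1)` for `n > 0`. -/
def coboundaries {X : ℕ → Type v} [∀ n, AddCommGroup (X n)] [∀ n, Module k (X n)]
    (d : ∀ n, X n →ₗ[k] X (n + 1)) : ∀ n, Submodule k (X n)
  | 0 => ⊥
  | n + 1 => LinearMap.range (d n)

/-- The `n`-th cohomology `Ker (d n) / Im (d (n - 1))` of a cochain complex of vector spaces
concentrated in nonnegative degrees. -/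
abbrev Cohomology {X : ℕ → Type v} [∀ n, AddCommGroup (X n)] [∀ n, Module k (X n)]
    (d : ∀ n, X n →ₗ[k] X (n + 1)) (n : ℕ) : Type v :=
  LinearMap.ker (d n) ⧸ (coboundaries d n).submoduleOf (LinearMap.ker (d n))

/-- The map induced on cohomology by a morphism of cochain complexes: it sends the class of a
cocycle `x` to the class of `f n x`. -/
def Cohomology.map {X : ℕ → Type v} [∀ n, AddCommGroup (X n)] [∀ n, Module k (X n)]
    {Y : ℕ → Type w} [∀ n, AddCommGroup (Y n)] [∀ n, Module k (Y n)]
    (d : ∀ n, X n →ₗ[k] X (n + 1)) (d' : ∀ n, Y n →ₗ[k] Y (n + 1))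
    (f : ∀ n, X n →ₗ[k] Y n) (hf : ∀ n x, f (n + 1) (d n x) = d' n (f n x)) (n : ℕ) :
    Cohomology d n →ₗ[k] Cohomology d' n :=
  Submodule.mapQ _ _
    ((f n).restrict (p := LinearMap.ker (d n)) (q := LinearMap.ker (d' n)) fun x hx => by
      rw [LinearMap.mem_ker] at hx ⊢
      rw [← hf, hx, map_zero])
    (by
      rintro ⟨x, hx⟩ h
      rw [Submodule.mem_comap]
      simp only [Submodule.submoduleOf, Submodule.mem_comap, Submodule.subtype_apply,
        LinearMap.coe_restrict_apply] at h ⊢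
      cases n with
      | zero =>
        simp only [coboundaries, Submodule.mem_bot] at h ⊢
        rw [h, map_zero]
      | succ n =>
        obtain ⟨y, rfl⟩ := h
        exact ⟨f n y, (hf n y).symm⟩)

end Cohomology

/-! ### Relative homological algebra -/

section Relative

variable {k : Type u} [Field k] {R : Type uR} [Ring R] [Algebra k R]

/-- The kernel of the `R`-linear map `f` is a direct summand, as a module over the
subalgebra `B`, of the source of `f`. -/
def KerIsSummand (B : Subalgebra k R) {L : Type v} {N : Type w} [AddCommGroup L] [Module R L]
    [AddCommGroup N] [Module R N] (f : L →ₗ[R] N) : Prop :=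
  ∃ C : Submodule B L, (∀ x : L, f x = 0 → x ∈ C → x = 0) ∧
    ∀ x : L, ∃ y z : L, f y = 0 ∧ z ∈ C ∧ y + z = x

/-- `P` is `(R, B)`-projective: every `R`-linear map `g : P → N` lifts along every surjective
`R`-linear map `π : L → N` whose kernel is a direct summand of `L` as a `B`-module, that is,
along every `(R, B)`-exact sequence `0 → K → L → N → 0`. -/
def IsRelProjective (B : Subalgebra k R) (P : Type w) [AddCommGroup P] [Module R P] : Prop :=
  ∀ (L N : Type (max uR w)) [AddCommGroup L] [Module R L] [AddCommGroup N] [Module R N]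
    (π : L →ₗ[R] N), Function.Surjective π → KerIsSummand B π →
    ∀ g : P →ₗ[R] N, ∃ g' : P →ₗ[R] L, π ∘ₗ g' = g

/-- A relative `B`-projective resolution `⋯ → P 2 → P 1 → P 0 → X → 0` of the `R`-module `X`:
an `(R, B)`-exact sequence of `R`-modules with every `P n` being `(R, B)`-projective. -/
structure RelProjResolution (B : Subalgebra k R) (X : Type uX) [AddCommGroup X] [Module R X] where
  P : ℕ → Type w
  [addCommGroup : ∀ n, AddCommGroup (P n)]
  [module : ∀ n, Module R (P n)]
  d : ∀ n, P (n + 1) →ₗ[R] P n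
  ε : P 0 →ₗ[R] X
  isRelProjective : ∀ n, IsRelProjective B (P n)
  surjective_ε : Function.Surjective ε
  exact_ε : LinearMap.range (d 0) = LinearMap.ker ε
  exact_d : ∀ n, LinearMap.range (d (n + 1)) = LinearMap.ker (d n)
  summand_ε : KerIsSummand B ε
  summand_d : ∀ n, KerIsSummand B (d n)

attribute [instance] RelProjResolution.addCommGroup RelProjResolution.module

/-- The relative `Ext^n_{R, B}(X, N)` computed with the relative `B`-projective resolution `P`
of `X`: the `n`-th cohomology of `Hom_R(P 0, N) → Hom_R(P 1, N) → Hom_R(P 2, N) → ⋯`. -/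
abbrev RelExt {B : Subalgebra k R} {X : Type uX} [AddCommGroup X] [Module R X]
    (P : RelProjResolution.{u, uR, uX, w} B X) (N : Type v) [AddCommGroup N] [Module k N]
    [Module R N] [IsScalarTower k R N] (n : ℕ) : Type (max w v) :=
  Cohomology (k := k) (X := fun n => P.P n →ₗ[R] N) (fun n => LinearMap.lcomp k N (P.d n)) n

end Relative

/-- A `k`-algebra `B` is separable if it has a separability idempotent: an element
`e = ∑ xᵢ ⊗ yᵢ` of `B ⊗ B` such that `∑ xᵢ yᵢ = 1` and `∑ b xᵢ ⊗ yᵢ = ∑ xᵢ ⊗ yᵢ b` for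
all `b`. -/
def IsSeparableAlgebra (k B : Type*) [Field k] [Ring B] [Algebra k B] : Prop :=
  ∃ e : B ⊗[k] B, LinearMap.mul' k B e = 1 ∧ ∀ b : B, (b ⊗ₜ[k] 1) * e = e * (1 ⊗ₜ[k] b)

/-! ### Equivariant bimodules -/

/-- The compatibility of the action of `Γ` on `M` with the left and the right action of `A`. A
right action of `A` is a left action of the opposite algebra, `m a = op a • m`. -/
class IsEquivariantBimodule (Γ : Type uG) (A : Type uA) (M : Type uM) [Group Γ] [Ring A]
    [MulSemiringAction Γ A] [AddCommGroup M] [Module A M] [Module Aᵐᵒᵖ M]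
    [DistribMulAction Γ M] : Prop where
  smul_left : ∀ (σ : Γ) (a : A) (m : M), σ • (a • m) = (σ • a) • (σ • m)
  smul_right : ∀ (σ : Γ) (a : A) (m : M), σ • (op a • m) = op (σ • a) • (σ • m)

instance (Γ : Type uG) (A : Type uA) [Group Γ] [Ring A] [MulSemiringAction Γ A] :
    IsEquivariantBimodule Γ A A where
  smul_left σ a m := by simp [smul_mul']
  smul_right σ a m := by simp [smul_mul']

/-! ### The algebra `(A, Γ)ᵉ` -/

section EquivEnv

variable (k : Type u) [Field k] (Γ : Type uG) [Group Γ] (A : Type uA) [Ring A] [Algebra k A]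

/-- The vector space `A ⊗ kΓ ⊗ A` underlying the algebra `(A, Γ)ᵉ`. -/
def EquivEnv : Type (max u uG uA) := (A ⊗[k] MonoidAlgebra k Γ) ⊗[k] A

instance : AddCommGroup (EquivEnv k Γ A) :=
  inferInstanceAs (AddCommGroup ((A ⊗[k] MonoidAlgebra k Γ) ⊗[k] A))

instance : Module k (EquivEnv k Γ A) :=
  inferInstanceAs (Module k ((A ⊗[k] MonoidAlgebra k Γ) ⊗[k] A))

namespace EquivEnv

variable {Γ A}

/-- The element `a ⊗ σ ⊗ b` of `(A, Γ)ᵉ`. -/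
def of (a : A) (σ : Γ) (b : A) : EquivEnv k Γ A := (a ⊗ₜ[k] MonoidAlgebra.single σ (1 : k)) ⊗ₜ[k] b

variable {k}

lemma of_add_left (a a' : A) (σ : Γ) (b : A) :
    of k (a + a') σ b = of k a σ b + of k a' σ b := by
  simp only [of, TensorProduct.add_tmul]; rfl

lemma of_add_right (a : A) (σ : Γ) (b b' : A) :
    of k a σ (b + b') = of k a σ b + of k a σ b' := by
  simp only [of, TensorProduct.tmul_add]; rfl

lemma of_smul_left (c : k) (a : A) (σ : Γ) (b : A) :
    of k (c • a) σ b = c • of k a σ b := rfl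

lemma of_smul_right (c : k) (a : A) (σ : Γ) (b : A) :
    of k a σ (c • b) = c • of k a σ b := by
  simp only [of, TensorProduct.tmul_smul]; rfl

@[elab_as_elim]
lemma induction {p : EquivEnv k Γ A → Prop} (hof : ∀ a σ b, p (of k a σ b))
    (hadd : ∀ x y, p x → p y → p (x + y)) (x : EquivEnv k Γ A) : p x := by
  have h0 : p 0 := by
    have h := hof (0 : A) (1 : Γ) (0 : A)
    rwa [show of k (0 : A) (1 : Γ) (0 : A) = 0 from TensorProduct.tmul_zero _ _] at h
  induction x using TensorProduct.induction_on with
  | zero => exact h0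
  | add x y hx hy => exact hadd x y hx hy
  | tmul x b =>
    induction x using TensorProduct.induction_on with
    | zero => rw [TensorProduct.zero_tmul]; exact h0
    | add x y hx hy => rw [TensorProduct.add_tmul]; exact hadd _ _ hx hy
    | tmul a s =>
      induction s using MonoidAlgebra.induction_linear with
      | zero => rw [TensorProduct.tmul_zero, TensorProduct.zero_tmul]; exact h0
      | add x y hx hy => rw [TensorProduct.tmul_add, TensorProduct.add_tmul]; exact hadd _ _ hx hy
      | single σ c =>
        have h := hof (c • a) σ b
        rwa [of, TensorProduct.smul_tmul, MonoidAlgebra.smul_single, smul_eq_mul, mul_one] at h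

/-- The linear map on `A ⊗ kΓ ⊗ A` determined by its values on the elements `a ⊗ σ ⊗ b`. -/
def lift {V : Type*} [AddCommGroup V] [Module k V] (f : Γ → A →ₗ[k] A →ₗ[k] V) :
    EquivEnv k Γ A →ₗ[k] V :=
  TensorProduct.lift (TensorProduct.lift
    ((Finsupp.lift (A →ₗ[k] A →ₗ[k] V) k Γ f ∘ₗ
      (MonoidAlgebra.coeffLinearEquiv k).toLinearMap).flip))

@[simp]
lemma lift_of {V : Type*} [AddCommGroup V] [Module k V] (f : Γ → A →ₗ[k] A →ₗ[k] V)
    (a : A) (σ : Γ) (b : A) : lift f (of k a σ b) = f σ a b := by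
  simp only [lift, of]
  erw [TensorProduct.lift.tmul, TensorProduct.lift.tmul]
  simp

variable [MulSemiringAction Γ A] [SMulCommClass Γ k A]

variable (k) in
/-- Left multiplication by `a ⊗ σ ⊗ b`: the linear map sending `c ⊗ τ ⊗ d` to
`a (σ c) ⊗ σ τ ⊗ (σ d) b`. -/
def mulLeft (σ : Γ) : A →ₗ[k] A →ₗ[k] (EquivEnv k Γ A →ₗ[k] EquivEnv k Γ A) :=
  LinearMap.mk₂ k
    (fun a b => lift fun τ => LinearMap.mk₂ k (fun c d => of k (a * (σ • c)) (σ * τ) ((σ • d) * b))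
      (by intros; rw [smul_add, mul_add, of_add_left])
      (by intros; rw [smul_comm, mul_smul_comm, of_smul_left])
      (by intros; rw [smul_add, add_mul, of_add_right])
      (by intros; rw [smul_comm, smul_mul_assoc, of_smul_right]))
    (by
      intros; ext x
      induction x using induction with
      | hof c τ d => simp [add_mul, of_add_left]
      | hadd x y hx hy => rw [map_add, hx, hy, map_add])
    (by
      intros; ext x
      induction x using induction with
      | hof c τ d => simp [of_smul_left]
      | hadd x y hx hy => rw [map_add, hx, hy, map_add])
    (by
      intros; ext x
      induction x using induction with
      | hof c τ d => simp [mul_add, of_add_right]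
      | hadd x y hx hy => rw [map_add, hx, hy, map_add])
    (by
      intros; ext x
      induction x using induction with
      | hof c τ d => simp [of_smul_right]
      | hadd x y hx hy => rw [map_add, hx, hy, map_add])

instance : Mul (EquivEnv k Γ A) := ⟨fun x y => lift (mulLeft k) x y⟩

instance : One (EquivEnv k Γ A) := ⟨of k 1 1 1⟩

lemma mul_def (x y : EquivEnv k Γ A) : x * y = lift (mulLeft k) x y := rfl

lemma one_def : (1 : EquivEnv k Γ A) = of k 1 1 1 := rfl

/-- The multiplication of `(A, Γ)ᵉ`. -/
@[simp]
lemma of_mul_of (a b c d : A) (σ τ : Γ) :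
    of k a σ b * of k c τ d = of k (a * (σ • c)) (σ * τ) ((σ • d) * b) := by
  simp [mul_def, mulLeft]

protected lemma add_mul' (x y z : EquivEnv k Γ A) : (x + y) * z = x * z + y * z := by
  simp [mul_def]

protected lemma mul_add' (x y z : EquivEnv k Γ A) : x * (y + z) = x * y + x * z := by
  simp [mul_def]

instance : Ring (EquivEnv k Γ A) where
  left_distrib := EquivEnv.mul_add'
  right_distrib := EquivEnv.add_mul'
  zero_mul x := by simp [mul_def]
  mul_zero x := by simp [mul_def]
  mul_assoc x y z := by
    induction x using induction with
    | hadd x x' hx hx' => simp only [EquivEnv.add_mul', hx, hx']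
    | hof a σ b =>
    induction y using induction with
    | hadd y y' hy hy' => simp only [EquivEnv.add_mul', EquivEnv.mul_add', hy, hy']
    | hof c τ d =>
    induction z using induction with
    | hadd z z' hz hz' => simp only [EquivEnv.mul_add', hz, hz']
    | hof e ρ f => simp [mul_assoc, smul_mul', mul_smul]
  one_mul x := by
    induction x using induction with
    | hadd x y hx hy => rw [EquivEnv.mul_add', hx, hy]
    | hof a σ b => simp [one_def]
  mul_one x := by
    induction x using induction with
    | hadd x y hx hy => rw [EquivEnv.add_mul', hx, hy]
    | hof a σ b => simp [one_def]
  zsmul := zsmulRec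
  neg_add_cancel := neg_add_cancel

instance : Algebra k (EquivEnv k Γ A) :=
  Algebra.ofModule (fun c x y => by simp [mul_def]) (fun c x y => by simp [mul_def])

variable (k Γ A) in
/-- The homomorphism of algebras `kΓ → (A, Γ)ᵉ` that sends `σ` to `1 ⊗ σ ⊗ 1`. -/
def groupAlgHom : MonoidAlgebra k Γ →ₐ[k] EquivEnv k Γ A :=
  MonoidAlgebra.lift k (EquivEnv k Γ A) Γ
    { toFun := fun σ => of k 1 σ 1
      map_one' := rfl
      map_mul' := fun σ τ => by simp }

variable (k Γ A) in
/-- The subalgebra `kΓ` of `(A, Γ)ᵉ`. -/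
def groupSubalgebra : Subalgebra k (EquivEnv k Γ A) := (groupAlgHom k Γ A).range

section Module

variable {M : Type uM} [AddCommGroup M] [Module k M] [Module A M] [Module Aᵐᵒᵖ M]
  [SMulCommClass A Aᵐᵒᵖ M] [IsScalarTower k A M] [IsScalarTower k Aᵐᵒᵖ M]
  [DistribMulAction Γ M] [SMulCommClass Γ k M]

variable (k Γ A M) in
/-- The element `a ⊗ σ ⊗ b` of `(A, Γ)ᵉ` acts on `M` by `m ↦ a (σ m) b`. -/
def smulHom : EquivEnv k Γ A →ₗ[k] M →ₗ[k] M :=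
  lift fun σ => LinearMap.mk₂ k
    (fun a b => Module.toModuleEnd k (S := A) M a ∘ₗ Module.toModuleEnd k (S := Aᵐᵒᵖ) M (op b) ∘ₗ
      DistribSMul.toLinearMap k M σ)
    (by intros; ext; simp [add_smul])
    (by intros; ext; simp)
    (by intros; ext; simp [add_smul])
    (by
      intro c a b; ext m
      simp only [LinearMap.comp_apply, Module.toModuleEnd_apply, DistribSMul.toLinearMap_apply,
        op_smul, smul_assoc, LinearMap.smul_apply]
      exact smul_comm a c _)

lemma smulHom_of (a b : A) (σ : Γ) (m : M) :
    smulHom k Γ A M (of k a σ b) m = a • op b • σ • m := by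
  simp [smulHom]

variable [IsEquivariantBimodule Γ A M]

/-- A `Γ`-equivariant `A`-bimodule is a module over `(A, Γ)ᵉ`. -/
instance instModule : Module (EquivEnv k Γ A) M where
  smul x m := smulHom k Γ A M x m
  one_smul m := (smulHom_of 1 1 1 m).trans (by simp)
  mul_smul x y m := by
    change smulHom k Γ A M (x * y) m = smulHom k Γ A M x (smulHom k Γ A M y m)
    induction x using induction with
    | hadd x x' hx hx' => simp only [add_mul, map_add, LinearMap.add_apply, hx, hx']
    | hof a σ b =>
    induction y using induction with
    | hadd y y' hy hy' => simp only [mul_add, map_add, LinearMap.add_apply, hy, hy']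
    | hof c τ d =>
      simp only [of_mul_of, smulHom_of, IsEquivariantBimodule.smul_left,
        IsEquivariantBimodule.smul_right, op_mul, mul_smul]
      rw [smul_comm (σ • c) (op b)]
  smul_zero x := map_zero _
  smul_add x := map_add _
  add_smul x y m := by
    change smulHom k Γ A M (x + y) m = smulHom k Γ A M x m + smulHom k Γ A M y m
    simp
  zero_smul m := by
    change smulHom k Γ A M 0 m = 0
    simp

lemma of_smul (a b : A) (σ : Γ) (m : M) : of k a σ b • m = a • op b • σ • m := smulHom_of a b σ m

instance : IsScalarTower k (EquivEnv k Γ A) M where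
  smul_assoc c x m := by
    change smulHom k Γ A M (c • x) m = c • smulHom k Γ A M x m
    simp

end Module

end EquivEnv
end EquivEnv

/-! ### The skew group algebra of the enveloping algebra -/

section EnvAlg

variable (k : Type u) [Field k] (Γ : Type uG) [Group Γ] (A : Type uA) [Ring A] [Algebra k A]

/-- The enveloping algebra `Aᵉ = A ⊗ Aᵒᵖ`. -/
def EnvAlg : Type uA := A ⊗[k] Aᵐᵒᵖ

instance : Ring (EnvAlg k A) := inferInstanceAs (Ring (A ⊗[k] Aᵐᵒᵖ))

instance : Algebra k (EnvAlg k A) := inferInstanceAs (Algebra k (A ⊗[k] Aᵐᵒᵖ))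

variable {A}

/-- The element `a ⊗ b` of the enveloping algebra. -/
def EnvAlg.of (a b : A) : EnvAlg k A := a ⊗ₜ[k] op b

variable {Γ} [MulSemiringAction Γ A] [SMulCommClass Γ k A]

variable (A) in
/-- The automorphism of the enveloping algebra given by `σ (a ⊗ b) = σ a ⊗ σ b`. -/
def EnvAlg.act (σ : Γ) : EnvAlg k A →ₐ[k] EnvAlg k A :=
  Algebra.TensorProduct.map (MulSemiringAction.toAlgHom k A σ)
    (AlgHom.op (MulSemiringAction.toAlgHom k A σ))

variable {k}

lemma EnvAlg.act_of (σ : Γ) (a b : A) :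
    EnvAlg.act k A σ (EnvAlg.of k a b) = EnvAlg.of k (σ • a) (σ • b) := rfl

lemma EnvAlg.induction {p : EnvAlg k A → Prop} (hof : ∀ a b, p (EnvAlg.of k a b))
    (hadd : ∀ x y, p x → p y → p (x + y)) (x : EnvAlg k A) : p x := by
  induction x using TensorProduct.induction_on with
  | zero => simpa [EnvAlg.of] using hof 0 0
  | add x y hx hy => exact hadd x y hx hy
  | tmul x b => exact hof x b.unop

instance : MulSemiringAction Γ (EnvAlg k A) where
  smul σ x := EnvAlg.act k A σ x
  one_smul x := by
    change EnvAlg.act k A 1 x = x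
    induction x using EnvAlg.induction with
    | hof a b => simp [EnvAlg.act_of]
    | hadd x y hx hy => rw [map_add, hx, hy]
  mul_smul σ τ x := by
    change EnvAlg.act k A (σ * τ) x = EnvAlg.act k A σ (EnvAlg.act k A τ x)
    induction x using EnvAlg.induction with
    | hof a b => simp [EnvAlg.act_of, mul_smul]
    | hadd x y hx hy => rw [map_add, hx, hy, map_add, map_add]
  smul_zero σ := map_zero (EnvAlg.act k A σ)
  smul_add σ := map_add (EnvAlg.act k A σ)
  smul_one σ := map_one (EnvAlg.act k A σ)
  smul_mul σ := map_mul (EnvAlg.act k A σ)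

lemma EnvAlg.smul_of (σ : Γ) (a b : A) :
    σ • EnvAlg.of k a b = EnvAlg.of k (σ • a) (σ • b) := rfl

instance : SMulCommClass Γ k (EnvAlg k A) where
  smul_comm σ c x := map_smul (EnvAlg.act k A σ) c x

variable (k Γ A) in
/-- The skew group algebra `Aᵉ ⋆ Γ`, with `(x ⋆ σ) (y ⋆ τ) = x (σ y) ⋆ σ τ`. -/
abbrev SkewEnv : Type (max uA uG) := SkewMonoidAlgebra (EnvAlg k A) Γ

end EnvAlg

/-! ### Hochschild cochains -/

section Hochschild

variable (k : Type u) [Field k] (A : Type uA) [Ring A] [Algebra k A] (M : Type uM)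
  [AddCommGroup M] [Module k M]

/-- The space of Hochschild `n`-cochains: `k`-linear maps `A ⊗ ⋯ ⊗ A → M`, that is,
`k`-multilinear maps in `n` variables. -/
abbrev HochCochain (n : ℕ) : Type (max uA uM) := MultilinearMap k (fun _ : Fin n => A) M

variable {k A M}

lemma contractNth_update_left {n : ℕ} (j : Fin n) (a : Fin (n + 1) → A) (i : Fin n)
    (hi : (i : ℕ) ≤ j) (x : A) :
    Fin.contractNth j.castSucc (· * ·) (Function.update a i.castSucc x) =
      Function.update (Fin.contractNth j.castSucc (· * ·) a) i
        (if (i : ℕ) < j then x else x * a i.succ) := by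
  funext l
  simp only [Fin.contractNth, Function.update_apply, Fin.ext_iff, Fin.val_castSucc, Fin.val_succ]
  split_ifs <;> first | rfl | omega | rw [show l = i from Fin.ext (by omega)]

lemma contractNth_update_right {n : ℕ} (j : Fin n) (a : Fin (n + 1) → A) (i : Fin n)
    (hi : (j : ℕ) ≤ i) (x : A) :
    Fin.contractNth j.castSucc (· * ·) (Function.update a i.succ x) =
      Function.update (Fin.contractNth j.castSucc (· * ·) a) i
        (if (i : ℕ) = j then a i.castSucc * x else x) := by
  funext l
  simp only [Fin.contractNth, Function.update_apply, Fin.ext_iff, Fin.val_castSucc, Fin.val_succ]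
  split_ifs <;> first | rfl | omega | rw [show l = i from Fin.ext (by omega)]

lemma contractNth_update {n : ℕ} (j : Fin n) (a : Fin (n + 1) → A) (i : Fin (n + 1)) :
    ∃ (l : Fin n) (f : A →ₗ[k] A), ∀ x : A,
      Fin.contractNth j.castSucc (· * ·) (Function.update a i x) =
        Function.update (Fin.contractNth j.castSucc (· * ·) a) l (f x) := by
  by_cases hi : (i : ℕ) ≤ j
  · obtain ⟨l, rfl⟩ : ∃ l : Fin n, l.castSucc = i := ⟨⟨i, by omega⟩, rfl⟩
    refine ⟨l, if (l : ℕ) < j then LinearMap.id else LinearMap.mulRight k (a l.succ),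
      fun x => ?_⟩
    rw [contractNth_update_left j a l hi x]
    split_ifs <;> rfl
  · obtain ⟨l, rfl⟩ : ∃ l : Fin n, l.succ = i := ⟨⟨i - 1, by omega⟩, by ext; simp; omega⟩
    refine ⟨l, if (l : ℕ) = j then LinearMap.mulLeft k (a l.castSucc) else LinearMap.id,
      fun x => ?_⟩
    rw [contractNth_update_right j a l (by simp at hi; omega) x]
    split_ifs <;> rfl

/-- The cochain `(a₁, …, aₙ₊₁) ↦ φ (a₁, …, aⱼ aⱼ₊₁, …, aₙ₊₁)`, where the index `j`
is counted from `0`. -/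
def HochCochain.contract {n : ℕ} (j : Fin n) (φ : HochCochain k A M n) :
    HochCochain k A M (n + 1) where
  toFun a := φ (Fin.contractNth j.castSucc (· * ·) a)
  map_update_add' := by
    intro inst a i x y
    rw [Subsingleton.elim inst (instDecidableEqFin (n + 1))]
    obtain ⟨l, f, hf⟩ := contractNth_update (k := k) j a i
    rw [hf, hf, hf, map_add, φ.map_update_add]
  map_update_smul' := by
    intro inst a i c x
    rw [Subsingleton.elim inst (instDecidableEqFin (n + 1))]
    obtain ⟨l, f, hf⟩ := contractNth_update (k := k) j a i
    rw [hf, hf, map_smul, φ.map_update_smul]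

variable [Module A M] [Module Aᵐᵒᵖ M]
  [SMulCommClass A Aᵐᵒᵖ M] [IsScalarTower k A M] [IsScalarTower k Aᵐᵒᵖ M]

/-- The cochain `(a₁, …, aₙ₊₁) ↦ a₁ φ (a₂, …, aₙ₊₁)`. -/
def HochCochain.first {n : ℕ} (φ : HochCochain k A M n) : HochCochain k A M (n + 1) :=
  LinearMap.uncurryLeft (M := fun _ : Fin (n + 1) => A)
    { toFun := fun a => (Module.toModuleEnd k (S := A) M a).compMultilinearMap φ
      map_add' := fun a b => by ext; simp [add_smul]
      map_smul' := fun c a => by ext; simp }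

/-- The cochain `(a₁, …, aₙ₊₁) ↦ φ (a₁, …, aₙ) aₙ₊₁`. -/
def HochCochain.last {n : ℕ} (φ : HochCochain k A M n) : HochCochain k A M (n + 1) :=
  MultilinearMap.uncurryRight (M := fun _ : Fin (n + 1) => A)
    (LinearMap.compMultilinearMap
      { toFun := fun m =>
          { toFun := fun a => op a • m
            map_add' := fun a b => by simp [add_smul]
            map_smul' := fun c a => by simp }
        map_add' := fun m m' => by ext; simp
        map_smul' := fun c m => by ext a; exact smul_comm (op a) c m } φ)

variable (k A M) in
/-- The Hochschild differential
`δ φ (a₁, …, aₙ₊₁) = a₁ φ (a₂, …, aₙ₊₁) + ∑ⱼ (-1) ^ j φ (a₁, …, aⱼ aⱼ₊₁, …, aₙ₊₁) +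
(-1) ^ (n + 1) φ (a₁, …, aₙ) aₙ₊₁`. -/
def hochDiff (n : ℕ) : HochCochain k A M n →ₗ[k] HochCochain k A M (n + 1) where
  toFun φ := φ.first + ∑ j : Fin n, (-1 : k) ^ ((j : ℕ) + 1) • φ.contract j +
    (-1 : k) ^ (n + 1) • φ.last
  map_add' φ ψ := by
    ext a
    simp only [HochCochain.first, HochCochain.last, HochCochain.contract,
      _root_.add_apply, _root_.sum_apply, _root_.smul_apply,
      MultilinearMap.coe_mk, LinearMap.uncurryLeft_apply, MultilinearMap.uncurryRight_apply,
      LinearMap.compMultilinearMap_apply, LinearMap.coe_mk, AddHom.coe_mk,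
      Module.toModuleEnd_apply, DistribSMul.toLinearMap_apply, smul_add, Finset.sum_add_distrib]
    abel
  map_smul' c φ := by
    ext a
    simp only [HochCochain.first, HochCochain.last, HochCochain.contract, RingHom.id_apply,
      _root_.add_apply, _root_.sum_apply, _root_.smul_apply,
      MultilinearMap.coe_mk, LinearMap.uncurryLeft_apply, MultilinearMap.uncurryRight_apply,
      LinearMap.compMultilinearMap_apply, LinearMap.coe_mk, AddHom.coe_mk,
      Module.toModuleEnd_apply, DistribSMul.toLinearMap_apply, smul_add, Finset.smul_sum]
    simp only [smul_comm c]

/-- The formula for the Hochschild differential. -/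
lemma hochDiff_apply (n : ℕ) (φ : HochCochain k A M n) (a : Fin (n + 1) → A) :
    hochDiff k A M n φ a = a 0 • φ (fun i => a i.succ) +
      ∑ j : Fin n, (-1 : k) ^ ((j : ℕ) + 1) • φ (Fin.contractNth j.castSucc (· * ·) a) +
      (-1 : k) ^ (n + 1) • op (a (Fin.last n)) • φ (fun i => a i.castSucc) := by
  simp only [hochDiff, HochCochain.first, HochCochain.last, HochCochain.contract,
      _root_.add_apply, _root_.sum_apply, _root_.smul_apply,
      MultilinearMap.coe_mk, LinearMap.uncurryLeft_apply, MultilinearMap.uncurryRight_apply,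
      LinearMap.compMultilinearMap_apply, LinearMap.coe_mk, AddHom.coe_mk,
      Module.toModuleEnd_apply, DistribSMul.toLinearMap_apply]
  rfl

/-! ### Equivariant Hochschild cohomology -/

variable (Γ : Type uG) [Group Γ] [MulSemiringAction Γ A] [SMulCommClass Γ k A]
  [DistribMulAction Γ M] [SMulCommClass Γ k M]

variable (k A M) in
/-- The subspace of the `Γ`-equivariant Hochschild `n`-cochains. -/
def equivariantCochains (n : ℕ) : Submodule k (HochCochain k A M n) where
  carrier := {φ | ∀ (σ : Γ) (a : Fin n → A), φ (fun i => σ • a i) = σ • φ a}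
  add_mem' hφ hψ σ a := by simp [hφ σ a, hψ σ a]
  zero_mem' σ a := by simp
  smul_mem' c φ hφ σ a := by simp [hφ σ a, smul_comm σ c]

/-! ### The total complex of Koam and Pirashvili -/

variable (k A M) in
/-- The action of `σ` on Hochschild cochains, `(σ φ) (a₁, …, aₙ) = σ (φ (σ⁻¹ a₁, …, σ⁻¹ aₙ))`. -/
def cochainAct {Γ : Type uG} [Group Γ] [MulSemiringAction Γ A] [SMulCommClass Γ k A]
    [DistribMulAction Γ M] [SMulCommClass Γ k M] (n : ℕ) (σ : Γ) :
    HochCochain k A M n →ₗ[k] HochCochain k A M n where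
  toFun φ := (DistribSMul.toLinearMap k M σ).compMultilinearMap
    (φ.compLinearMap fun _ => DistribSMul.toLinearMap k A σ⁻¹)
  map_add' φ ψ := by ext; simp
  map_smul' c φ := by ext; simp

variable (k A M) in
/-- The space in bidegree `(p, q)`: maps from `Γ ^ p` to the Hochschild `q`-cochains. -/
abbrev BiCochain (p q : ℕ) : Type (max uG uA uM) := (Fin p → Γ) → HochCochain k A M q

variable (k A M) in
/-- The differential in the group direction: the differential of the (inhomogeneous) cochain
complex of `Γ` with coefficients in the `Γ`-module of the Hochschild `q`-cochains,
`(d f) (σ₁, …, σₚ₊₁) = σ₁ f (σ₂, …, σₚ₊₁) + ∑ⱼ (-1) ^ j f (σ₁, …, σⱼ σⱼ₊₁, …, σₚ₊₁) +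
(-1) ^ (p + 1) f (σ₁, …, σₚ)`. -/
def groupDiff (p q : ℕ) : BiCochain k A M Γ p q →ₗ[k] BiCochain k A M Γ (p + 1) q where
  toFun f g := cochainAct k A M q (g 0) (f fun i => g i.succ) +
    ∑ j : Fin p, (-1 : k) ^ ((j : ℕ) + 1) • f (Fin.contractNth j.castSucc (· * ·) g) +
    (-1 : k) ^ (p + 1) • f (fun i => g i.castSucc)
  map_add' f f' := by
    funext g
    simp only [Pi.add_apply, map_add, smul_add, Finset.sum_add_distrib]
    abel
  map_smul' c f := by
    funext g
    simp only [Pi.smul_apply, map_smul, smul_add, Finset.smul_sum, RingHom.id_apply]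
    simp only [smul_comm c]

variable (k A M) in
/-- The Hochschild differential on the bicomplex. -/
def hochDirDiff (p q : ℕ) : BiCochain k A M Γ p q →ₗ[k] BiCochain k A M Γ p (q + 1) :=
  (hochDiff k A M q).compLeft (Fin p → Γ)

/-- The bidegrees `(p, q)` of total degree `n`. -/
abbrev Bidegree (n : ℕ) : Type := {x : ℕ × ℕ // x.2 + x.1 = n}

variable (k A M) in
/-- The total complex in degree `n`: the direct sum of the spaces in the (finitely many)
bidegrees `(p, q)` with `p + q = n`. -/
abbrev TotCochain (n : ℕ) : Type (max uG uA uM) :=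
  ∀ x : Bidegree n, BiCochain k A M Γ x.1.1 x.1.2

variable (k A M) in
/-- The component in bidegree `x` of the part of the total differential in the group direction. -/
def totGroup (n : ℕ) : ∀ x : Bidegree (n + 1),
    TotCochain k A M Γ n →ₗ[k] BiCochain k A M Γ x.1.1 x.1.2
  | ⟨(0, _), _⟩ => 0
  | ⟨(p + 1, q), h⟩ => groupDiff k A M Γ p q ∘ₗ
      LinearMap.proj (⟨(p, q), Nat.succ.inj h⟩ : Bidegree n)

variable (k A M) in
/-- The component in bidegree `x` of the part of the total differential in the Hochschild
direction, with the sign `(-1) ^ p`. -/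
def totHoch (n : ℕ) : ∀ x : Bidegree (n + 1),
    TotCochain k A M Γ n →ₗ[k] BiCochain k A M Γ x.1.1 x.1.2
  | ⟨(_, 0), _⟩ => 0
  | ⟨(p, q + 1), h⟩ => (-1 : k) ^ p • hochDirDiff k A M Γ p q ∘ₗ
      LinearMap.proj (⟨(p, q), by simp only at h ⊢; omega⟩ : Bidegree n)

variable (k A M) in
/-- The differential of the total complex. -/
def totDiff (n : ℕ) : TotCochain k A M Γ n →ₗ[k] TotCochain k A M Γ (n + 1) :=
  LinearMap.pi fun x => totGroup k A M Γ n x + totHoch k A M Γ n x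

variable (k A M) in
/-- The equivariant Hochschild cohomology `H^n_Γ(A, M)` of Koam and Pirashvili: the cohomology
of the total complex. -/
abbrev KoamPirashvili (n : ℕ) : Type (max uG uA uM) := Cohomology (totDiff k A M Γ) n

variable [IsEquivariantBimodule Γ A M]

lemma hochDiff_mem (n : ℕ) (φ : HochCochain k A M n) (hφ : φ ∈ equivariantCochains k A M Γ n) :
    hochDiff k A M n φ ∈ equivariantCochains k A M Γ (n + 1) := by
  intro σ a
  have h : ∀ j : Fin n, Fin.contractNth j.castSucc (· * ·) (fun i => σ • a i) =
      fun i => σ • Fin.contractNth j.castSucc (· * ·) a i := fun j =>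
    (Fin.comp_contractNth (· * ·) (· * ·) (f := fun x : A => σ • x)
      (fun x y => smul_mul' σ x y) j.castSucc a).symm
  rw [hochDiff_apply, hochDiff_apply]
  simp only [h]
  rw [hφ σ (fun i => a i.succ), hφ σ (fun i => a i.castSucc), smul_add, smul_add,
    Finset.smul_sum, IsEquivariantBimodule.smul_left, smul_comm σ ((-1 : k) ^ (n + 1)),
    IsEquivariantBimodule.smul_right]
  congr 2
  refine Finset.sum_congr rfl fun j _ => ?_
  rw [hφ σ, smul_comm σ]

variable (k A M) in
/-- The differential of the subcomplex of the `Γ`-equivariant Hochschild cochains. -/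
def equivariantDiff (n : ℕ) :
    equivariantCochains k A M Γ n →ₗ[k] equivariantCochains k A M Γ (n + 1) :=
  (hochDiff k A M n).restrict (hochDiff_mem Γ n)

variable (k A M) in
/-- The equivariant Hochschild cohomology `HH^n_Γ(A, M)`: the cohomology of the complex of the
`Γ`-equivariant Hochschild cochains. -/
abbrev EquivariantHH (n : ℕ) : Type (max uA uM) := Cohomology (equivariantDiff k A M Γ) n

/-! ### The comparison map -/

variable (k A M) in
/-- The components of the inclusion of the equivariant Hochschild cochains in the column `p = 0`
of the bicomplex. -/
def edgeComponent : ∀ (n : ℕ) (x : Bidegree n),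
    equivariantCochains k A M Γ n →ₗ[k] BiCochain k A M Γ x.1.1 x.1.2
  | _, ⟨(0, _), rfl⟩ => LinearMap.pi fun _ => Submodule.subtype _
  | _, ⟨(_ + 1, _), _⟩ => 0

variable (k A M) in
/-- The inclusion of the equivariant Hochschild cochains in the total complex: an equivariant
`n`-cochain is regarded as an element of bidegree `(0, n)`. -/
def edge (n : ℕ) : equivariantCochains k A M Γ n →ₗ[k] TotCochain k A M Γ n :=
  LinearMap.pi (edgeComponent k A M Γ n)

lemma cochainAct_of_mem (n : ℕ) (φ : HochCochain k A M n)
    (hφ : φ ∈ equivariantCochains k A M Γ n) (σ : Γ) : cochainAct k A M n σ φ = φ := by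
  ext a
  simp only [cochainAct, LinearMap.coe_mk, AddHom.coe_mk, LinearMap.compMultilinearMap_apply,
    MultilinearMap.compLinearMap_apply, DistribSMul.toLinearMap_apply]
  rw [hφ σ⁻¹ a, smul_inv_smul]

lemma edge_comm (n : ℕ) (φ : equivariantCochains k A M Γ n) :
    edge k A M Γ (n + 1) (equivariantDiff k A M Γ n φ) =
      totDiff k A M Γ n (edge k A M Γ n φ) := by
  funext ⟨⟨p, q⟩, h⟩
  rcases p with _ | p
  · obtain rfl : q = n + 1 := h
    funext g
    simp only [edge, totDiff, LinearMap.pi_apply, LinearMap.add_apply, Pi.add_apply]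
    simp only [edgeComponent, totGroup, totHoch, LinearMap.zero_apply, Pi.zero_apply, zero_add,
      pow_zero, one_smul]
    rfl
  · have hH : totHoch k A M Γ n ⟨(p + 1, q), h⟩ (edge k A M Γ n φ) = 0 := by
      rcases q with _ | q
      · rfl
      · simp only [totHoch, LinearMap.smul_apply, LinearMap.comp_apply]
        have : (LinearMap.proj (⟨(p + 1, q), by simp only at h ⊢; omega⟩ : Bidegree n) :
            TotCochain k A M Γ n →ₗ[k] _) (edge k A M Γ n φ) = 0 := rfl
        rw [this, map_zero, smul_zero]
    have hG : totGroup k A M Γ n ⟨(p + 1, q), h⟩ (edge k A M Γ n φ) = 0 := by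
      simp only [totGroup, LinearMap.comp_apply]
      rcases p with _ | p
      · obtain rfl : q = n := Nat.succ.inj h
        have : (LinearMap.proj (⟨(0, q), rfl⟩ : Bidegree q) :
            TotCochain k A M Γ q →ₗ[k] _) (edge k A M Γ q φ) = fun _ => φ.1 := rfl
        rw [this]
        funext g
        simp [groupDiff, cochainAct_of_mem Γ q φ.1 φ.2]
      · have : (LinearMap.proj (⟨(p + 1, q), Nat.succ.inj h⟩ : Bidegree n) :
            TotCochain k A M Γ n →ₗ[k] _) (edge k A M Γ n φ) = 0 := rfl
        rw [this, map_zero]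
    change 0 = totGroup k A M Γ n ⟨(p + 1, q), h⟩ (edge k A M Γ n φ) +
      totHoch k A M Γ n ⟨(p + 1, q), h⟩ (edge k A M Γ n φ)
    rw [hH, hG, add_zero]

variable (k A M) in
/-- The natural map `HH^n_Γ(A, M) → H^n_Γ(A, M)`, induced by the inclusion of the equivariant
Hochschild cochains in the total complex. -/
def comparison (n : ℕ) : EquivariantHH k A M Γ n →ₗ[k] KoamPirashvili k A M Γ n :=
  Cohomology.map _ _ (edge k A M Γ) (edge_comm Γ) n

end Hochschild

/-! ### Functoriality -/

section Functoriality

/-- A morphism from the pair `(A, M)` to the pair `(A', M')`, each consisting of a `Γ`-algebra and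
a `Γ`-equivariant bimodule over it: a `Γ`-equivariant homomorphism of algebras `A' → A`
together with a `Γ`-equivariant homomorphism `M → M'` of `A'`-bimodules. For `A' = A` and
the identity of `A` these are the homomorphisms of `Γ`-equivariant `A`-bimodules. -/
structure EquivariantPairHom (k : Type u) [Field k] (Γ : Type uG) [Group Γ]
    (A : Type uA) [Ring A] [Algebra k A] [MulSemiringAction Γ A]
    (M : Type uM) [AddCommGroup M] [Module k M] [Module A M] [Module Aᵐᵒᵖ M]
    [DistribMulAction Γ M]
    (A' : Type uA') [Ring A'] [Algebra k A'] [MulSemiringAction Γ A']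
    (M' : Type uM') [AddCommGroup M'] [Module k M'] [Module A' M'] [Module A'ᵐᵒᵖ M']
    [DistribMulAction Γ M'] where
  algHom : A' →ₐ[k] A
  linMap : M →ₗ[k] M'
  algHom_smul : ∀ (σ : Γ) (a : A'), algHom (σ • a) = σ • algHom a
  linMap_smul : ∀ (σ : Γ) (m : M), linMap (σ • m) = σ • linMap m
  linMap_left : ∀ (a : A') (m : M), linMap (algHom a • m) = a • linMap m
  linMap_right : ∀ (a : A') (m : M), linMap (op (algHom a) • m) = op a • linMap m

namespace EquivariantPairHom

variable {k : Type u} [Field k] {Γ : Type uG} [Group Γ]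
  {A : Type uA} [Ring A] [Algebra k A] [MulSemiringAction Γ A] [SMulCommClass Γ k A]
  {M : Type uM} [AddCommGroup M] [Module k M] [Module A M] [Module Aᵐᵒᵖ M]
  [SMulCommClass A Aᵐᵒᵖ M] [IsScalarTower k A M] [IsScalarTower k Aᵐᵒᵖ M]
  [DistribMulAction Γ M] [SMulCommClass Γ k M] [IsEquivariantBimodule Γ A M]
  {A' : Type uA'} [Ring A'] [Algebra k A'] [MulSemiringAction Γ A'] [SMulCommClass Γ k A']
  {M' : Type uM'} [AddCommGroup M'] [Module k M'] [Module A' M'] [Module A'ᵐᵒᵖ M']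
  [SMulCommClass A' A'ᵐᵒᵖ M'] [IsScalarTower k A' M'] [IsScalarTower k A'ᵐᵒᵖ M']
  [DistribMulAction Γ M'] [SMulCommClass Γ k M'] [IsEquivariantBimodule Γ A' M']
  (F : EquivariantPairHom k Γ A M A' M')

/-- The map `φ ↦ ((a₁, …, aₙ) ↦ u (φ (α a₁, …, α aₙ)))` induced by a morphism `(α, u)`. -/
def cochain (n : ℕ) : HochCochain k A M n →ₗ[k] HochCochain k A' M' n where
  toFun φ := F.linMap.compMultilinearMap (φ.compLinearMap fun _ => F.algHom.toLinearMap)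
  map_add' φ ψ := by ext; simp
  map_smul' c φ := by ext; simp

lemma cochain_apply (n : ℕ) (φ : HochCochain k A M n) (a : Fin n → A') :
    F.cochain n φ a = F.linMap (φ fun i => F.algHom (a i)) := rfl

lemma cochain_hochDiff (n : ℕ) (φ : HochCochain k A M n) :
    F.cochain (n + 1) (hochDiff k A M n φ) = hochDiff k A' M' n (F.cochain n φ) := by
  ext a
  have h : ∀ j : Fin n, Fin.contractNth j.castSucc (· * ·) (fun i => F.algHom (a i)) =
      fun i => F.algHom (Fin.contractNth j.castSucc (· * ·) a i) := fun j =>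
    (Fin.comp_contractNth (· * ·) (· * ·) (f := F.algHom)
      (fun x y => map_mul F.algHom x y) j.castSucc a).symm
  rw [hochDiff_apply, cochain_apply, hochDiff_apply]
  simp only [h, cochain_apply, map_add, map_sum, map_smul, F.linMap_left, F.linMap_right]

lemma cochain_mem (n : ℕ) (φ : HochCochain k A M n) (hφ : φ ∈ equivariantCochains k A M Γ n) :
    F.cochain n φ ∈ equivariantCochains k A' M' Γ n := by
  intro σ a
  rw [cochain_apply, cochain_apply, ← F.linMap_smul, ← hφ σ]
  simp only [F.algHom_smul]

/-- The induced map on equivariant Hochschild cohomology `HH^n_Γ`. -/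
def mapHH (n : ℕ) : EquivariantHH k A M Γ n →ₗ[k] EquivariantHH k A' M' Γ n :=
  Cohomology.map (equivariantDiff k A M Γ) (equivariantDiff k A' M' Γ)
    (fun n => (F.cochain n).restrict (F.cochain_mem n))
    (fun n φ => Subtype.ext (F.cochain_hochDiff n φ.1)) n

lemma cochain_act (n : ℕ) (σ : Γ) (φ : HochCochain k A M n) :
    F.cochain n (cochainAct k A M n σ φ) = cochainAct k A' M' n σ (F.cochain n φ) := by
  ext a
  simp [cochain_apply, cochainAct, F.algHom_smul, F.linMap_smul]

/-- The induced map on the total complexes. -/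
def tot (n : ℕ) : TotCochain k A M Γ n →ₗ[k] TotCochain k A' M' Γ n :=
  LinearMap.pi fun x => (F.cochain x.1.2).compLeft (Fin x.1.1 → Γ) ∘ₗ LinearMap.proj x

lemma tot_totDiff (n : ℕ) (f : TotCochain k A M Γ n) :
    F.tot (n + 1) (totDiff k A M Γ n f) = totDiff k A' M' Γ n (F.tot n f) := by
  funext ⟨⟨p, q⟩, h⟩ g
  simp only [tot, totDiff, LinearMap.pi_apply, LinearMap.comp_apply, LinearMap.proj_apply,
    LinearMap.add_apply, LinearMap.compLeft_apply, Function.comp_apply, Pi.add_apply, map_add]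
  congr 1
  · rcases p with _ | p
    · simp [totGroup]
    · simp only [totGroup, LinearMap.comp_apply, LinearMap.proj_apply, groupDiff,
        LinearMap.coe_mk, AddHom.coe_mk, map_add, map_sum, map_smul, cochain_act,
        LinearMap.pi_apply, LinearMap.compLeft_apply, Function.comp_apply]
  · rcases q with _ | q
    · simp [totHoch]
    · simp only [totHoch, LinearMap.comp_apply, LinearMap.proj_apply, hochDirDiff,
        LinearMap.smul_apply, Pi.smul_apply, map_smul, cochain_hochDiff,
        LinearMap.pi_apply, LinearMap.compLeft_apply, Function.comp_apply]

/-- The induced map on the cohomology `H^n_Γ` of Koam and Pirashvili. -/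
def mapKP (n : ℕ) : KoamPirashvili k A M Γ n →ₗ[k] KoamPirashvili k A' M' Γ n :=
  Cohomology.map _ _ F.tot F.tot_totDiff n

end EquivariantPairHom

end Functoriality

end

/-! ### Isomorphisms in cohomology -/

section Cohomology

variable {k : Type u} [Field k]
  {X : ℕ → Type v} [∀ n, AddCommGroup (X n)] [∀ n, Module k (X n)]
  {Y : ℕ → Type w} [∀ n, AddCommGroup (Y n)] [∀ n, Module k (Y n)]
  {d : ∀ n, X n →ₗ[k] X (n + 1)} {d' : ∀ n, Y n →ₗ[k] Y (n + 1)}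

/-! The algebra isomorphism is a reordering of tensor factors: the twisted product of `(A, Γ)ᵉ` is
the skew product once the right-hand copy of `A` is read as `Aᵒᵖ`.

For the relative Ext, the key object is the bimodule `A ⊗ V ⊗ A` attached to a representation `V` of
`Γ`. It is `V` induced from `kΓ` to `(A, Γ)ᵉ`: homomorphisms out of it are the `Γ`-maps out of `V`
(`InducedBimodule.extend`, `InducedBimodule.hom_ext`), so it is relatively projective
(`InducedBimodule.relLifts`). For `V = A ⊗ ⋯ ⊗ A` with the diagonal action these bimodules form the
bar complex. Its usual contraction inserts the `Γ`-fixed element `1`, hence is `Γ`-equivariant and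
splits the complex over `kΓ` in every characteristic (`s_smul`, `d_s_succ`). Homomorphisms from the
bar resolution to `M` form exactly the complex of equivariant cochains (`homEquiv_comp_d`). The
comparison theorem for relative resolutions (`exists_chainMap`, `exists_homotopy`) then replaces the
bar resolution by any other.

The edge map to the bicomplex is natural already on cochains. If `kΓ` is separable, then applying
the augmentation to the second factor of the separability idempotent gives a `Γ`-invariant element
of augmentation `1`, which forces the order of `Γ` to be invertible in `k`
(`IsSeparableAlgebra.natCard_ne_zero`). Summation over the last group variable, suitably normalised,
then contracts every row of the bicomplex onto its invariants (`sumLast_groupDiff`). It commutes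
with the Hochschild differential, so with its signs it anticommutes with the Hochschild part of the
total differential. It is therefore a homotopy on the total complex from the identity to averaging
in the column `p = 0` followed by the edge inclusion (`totHomotopy_totDiff_succ`), and no spectral
sequence is needed. -/

lemma map_mem_coboundaries {f : ∀ n, X n →ₗ[k] Y n}
    (hf : ∀ n x, f (n + 1) (d n x) = d' n (f n x)) (n : ℕ) {x : X n}
    (hx : x ∈ coboundaries d n) : f n x ∈ coboundaries d' n := by
  cases n with
  | zero =>
    simp only [coboundaries, Submodule.mem_bot] at hx ⊢
    rw [hx, map_zero]
  | succ n =>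
    obtain ⟨y, rfl⟩ := hx
    exact ⟨f n y, (hf n y).symm⟩

/-- A morphism of complexes induces a bijection in cohomology if it has an inverse modulo
coboundaries on cocycles. -/
lemma Cohomology.map_bijective (f : ∀ n, X n →ₗ[k] Y n)
    (hf : ∀ n x, f (n + 1) (d n x) = d' n (f n x)) (g : ∀ n, Y n →ₗ[k] X n)
    (hg : ∀ n y, g (n + 1) (d' n y) = d n (g n y)) (n : ℕ)
    (hgf : ∀ x, d n x = 0 → g n (f n x) - x ∈ coboundaries d n)
    (hfg : ∀ y, d' n y = 0 → f n (g n y) - y ∈ coboundaries d' n) :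
    Function.Bijective (Cohomology.map d d' f hf n) := by
  constructor
  · rw [injective_iff_map_eq_zero]
    intro x
    obtain ⟨⟨x, hx⟩, rfl⟩ := Submodule.Quotient.mk_surjective _ x
    intro h
    have h' : f n x ∈ coboundaries d' n :=
      (Submodule.Quotient.mk_eq_zero ((coboundaries d' n).submoduleOf _)).1 h
    refine (Submodule.Quotient.mk_eq_zero _).2 ?_
    have := Submodule.sub_mem _ (map_mem_coboundaries hg n h') (hgf x hx)
    rwa [sub_sub_cancel] at this
  · intro y
    obtain ⟨⟨y, hy⟩, rfl⟩ := Submodule.Quotient.mk_surjective _ y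
    have hy' : d' n y = 0 := hy
    refine ⟨Submodule.Quotient.mk ⟨g n y, ?_⟩, ?_⟩
    · rw [LinearMap.mem_ker, ← hg, hy', map_zero]
    · exact (Submodule.Quotient.eq _).2 (hfg y hy)

lemma Cohomology.map_comp {Z : ℕ → Type*} [∀ n, AddCommGroup (Z n)] [∀ n, Module k (Z n)]
    {d'' : ∀ n, Z n →ₗ[k] Z (n + 1)} (f : ∀ n, X n →ₗ[k] Y n)
    (hf : ∀ n x, f (n + 1) (d n x) = d' n (f n x)) (g : ∀ n, Y n →ₗ[k] Z n)
    (hg : ∀ n y, g (n + 1) (d' n y) = d'' n (g n y)) (n : ℕ) :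
    Cohomology.map d' d'' g hg n ∘ₗ Cohomology.map d d' f hf n =
      Cohomology.map d d'' (fun n => g n ∘ₗ f n)
        (fun n x => by simp only [LinearMap.comp_apply, hf, hg]) n := by
  apply LinearMap.ext
  intro x
  obtain ⟨⟨x, hx⟩, rfl⟩ := Submodule.Quotient.mk_surjective _ x
  rfl

end Cohomology

/-! ### The comparison theorem of relative homological algebra -/

section Relative

variable {k : Type u} [Field k] {R : Type uR} [Ring R] [Algebra k R] {B : Subalgebra k R}

/-- The kernel of `f` is a direct summand over `B` if there is a map `s` of `B`-modules in the
opposite direction such that `f s f = f`. -/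
lemma KerIsSummand.of_section {L : Type v} {N : Type w} [AddCommGroup L] [Module R L]
    [AddCommGroup N] [Module R N] (f : L →ₗ[R] N) (s : N →ₗ[B] L)
    (hs : ∀ x, f (s (f x)) = f x) : KerIsSummand B f := by
  refine ⟨LinearMap.range (s ∘ₗ f.restrictScalars B), ?_, fun x => ?_⟩
  · rintro _ hx ⟨y, rfl⟩
    have h : f y = 0 := (hs y).symm.trans hx
    simp [h]
  · exact ⟨x - s (f x), s (f x), by rw [map_sub, hs, sub_self], ⟨x, rfl⟩, sub_add_cancel _ _⟩

/-- A map whose kernel is a direct summand over `B` has a section over `B` on its range. -/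
lemma KerIsSummand.exists_section {L : Type v} {N : Type w} [AddCommGroup L] [Module R L]
    [AddCommGroup N] [Module R N] {f : L →ₗ[R] N} (h : KerIsSummand B f) :
    ∃ s : LinearMap.range (f.restrictScalars B) →ₗ[B] L, ∀ x, f (s x) = x := by
  obtain ⟨C, hC, hsum⟩ := h
  -- The complement `C` meets the kernel trivially and together with it spans `L`, so `f` carries it
  -- isomorphically onto its range; the inverse is the section.
  let g : C →ₗ[B] LinearMap.range (f.restrictScalars B) :=
    (f.restrictScalars B).rangeRestrict.domRestrict C
  have hg : Function.Bijective g := by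
    constructor
    · rw [injective_iff_map_eq_zero]
      rintro ⟨x, hx⟩ h0
      exact Subtype.ext (hC x (congrArg Subtype.val h0) hx)
    · rintro ⟨_, x, rfl⟩
      obtain ⟨y, z, hy, hz, rfl⟩ := hsum x
      refine ⟨⟨z, hz⟩, Subtype.ext ?_⟩
      change f z = f (y + z)
      rw [map_add, hy, zero_add]
  refine ⟨C.subtype ∘ₗ (LinearEquiv.ofBijective g hg).symm.toLinearMap, fun x => ?_⟩
  exact congrArg Subtype.val ((LinearEquiv.ofBijective g hg).apply_symm_apply x)

/-- Composing with a section over `B` preserves every linear relation over `B`. Phrasing this for a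
bare family `y`, relation by relation, avoids putting a `B`-module structure on the index type,
which in the application is a representation of `Γ`. -/
lemma KerIsSummand.exists_lift {L : Type v} {N : Type w} [AddCommGroup L] [Module R L]
    [AddCommGroup N] [Module R N] {f : L →ₗ[R] N} (h : KerIsSummand B f) {V : Type*} (y : V → N)
    (hy : ∀ v, y v ∈ LinearMap.range f) :
    ∃ φ : V → L, (∀ v, f (φ v) = y v) ∧
      (∀ v v' v'', y v'' = y v + y v' → φ v'' = φ v + φ v') ∧
      ∀ r ∈ B, ∀ v v', y v' = r • y v → φ v' = r • φ v := by
  obtain ⟨s, hs⟩ := h.exists_section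
  refine ⟨fun v => s ⟨y v, hy v⟩, fun v => hs _, fun v v' v'' h => ?_, fun r hr v v' h => ?_⟩
  · exact (congrArg s (Subtype.ext h)).trans (map_add s ⟨y v, hy v⟩ ⟨y v', hy v'⟩)
  · exact (congrArg s (Subtype.ext h)).trans (map_smul s (⟨r, hr⟩ : B) ⟨y v, hy v⟩)

/-- Maps from `P` to `N` lift along every map `π : L → N` whose kernel is a direct summand
over `B`, provided that their range is contained in that of `π`. -/
def RelLifts (B : Subalgebra k R) (P : Type*) [AddCommGroup P] [Module R P]
    (L : Type v) [AddCommGroup L] [Module R L] (N : Type w) [AddCommGroup N] [Module R N] : Prop :=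
  ∀ π : L →ₗ[R] N, KerIsSummand B π → ∀ g : P →ₗ[R] N, LinearMap.range g ≤ LinearMap.range π →
    ∃ g' : P →ₗ[R] L, π ∘ₗ g' = g

lemma IsRelProjective.of_relLifts {P : Type w} [AddCommGroup P] [Module R P]
    (h : ∀ (L N : Type (max uR w)) [AddCommGroup L] [Module R L] [AddCommGroup N] [Module R N],
      RelLifts B P L N) : IsRelProjective B P :=
  fun L N _ _ _ _ π hπ hker g =>
    h L N π hker g (by rw [LinearMap.range_eq_top.2 hπ]; exact le_top)

/-- Corestricting `π` to its range makes it surjective, and a section of `π` on that range splits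
the corestricted map as well. Non-surjective `π` are what occurs when lifting along the
differentials of a resolution. -/
lemma IsRelProjective.relLifts {P : Type w} [AddCommGroup P] [Module R P]
    (hP : IsRelProjective B P) (L N : Type (max uR w)) [AddCommGroup L] [Module R L]
    [AddCommGroup N] [Module R N] : RelLifts B P L N := by
  intro π hπ g hg
  obtain ⟨s, hs⟩ := hπ.exists_section
  obtain ⟨g', hg'⟩ := hP L (LinearMap.range π) π.rangeRestrict π.surjective_rangeRestrict
    (KerIsSummand.of_section (N := LinearMap.range π) _ s fun x => Subtype.ext (hs _))
    (Submodule.inclusion hg ∘ₗ g.rangeRestrict)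
  exact ⟨g', LinearMap.ext fun x => congrArg Subtype.val (LinearMap.congr_fun hg' x)⟩

/-- Relative projectivity tests only modules in one universe. Transporting `π`, `g` and the
complement along `ULift` makes it available for modules in smaller universes. -/
lemma RelLifts.of_uLift {P : Type*} [AddCommGroup P] [Module R P]
    {L : Type v} {N : Type w} [AddCommGroup L] [Module R L] [AddCommGroup N] [Module R N]
    (h : RelLifts B P (ULift.{uX} L) (ULift.{uA} N)) : RelLifts B P L N := by
  intro π hπ g hg
  let eL : ULift.{uX} L ≃ₗ[R] L := ULift.moduleEquiv
  let eN : ULift.{uA} N ≃ₗ[R] N := ULift.moduleEquiv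
  obtain ⟨C, hC, hsum⟩ := hπ
  obtain ⟨g', hg'⟩ := h (eN.symm.toLinearMap ∘ₗ π ∘ₗ eL.toLinearMap)
    ⟨C.comap (eL.restrictScalars B).toLinearMap,
      fun x hx hxC => eL.injective ((hC (eL x) (eN.symm.injective hx) hxC).trans eL.map_zero.symm),
      fun x => by
        obtain ⟨y, z, hy, hz, hyz⟩ := hsum (eL x)
        exact ⟨eL.symm y, eL.symm z, congrArg eN.symm hy, hz, congrArg eL.symm hyz⟩⟩
    (eN.symm.toLinearMap ∘ₗ g) (by
      rintro _ ⟨x, rfl⟩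
      obtain ⟨y, hy⟩ := hg ⟨x, rfl⟩
      exact ⟨eL.symm y, congrArg eN.symm hy⟩)
  exact ⟨eL.toLinearMap ∘ₗ g', LinearMap.ext fun x =>
    eN.symm.injective (LinearMap.congr_fun hg' x)⟩

/-! ### Chain maps and homotopies into relatively exact complexes -/

section Comparison

variable {X : ℕ → Type v} [∀ n, AddCommGroup (X n)] [∀ n, Module R (X n)]
  {Y : ℕ → Type w} [∀ n, AddCommGroup (Y n)] [∀ n, Module R (Y n)]
  {d : ∀ n, X (n + 1) →ₗ[R] X n} {d' : ∀ n, Y (n + 1) →ₗ[R] Y n}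

/-- Lifting of a map to a morphism of complexes. -/
lemma exists_chainMap (hX : ∀ n, RelLifts B (X (n + 1)) (Y (n + 1)) (Y n))
    (hd : ∀ n, d n ∘ₗ d (n + 1) = 0) (hd' : ∀ n, LinearMap.range (d' (n + 1)) = LinearMap.ker (d' n))
    (hs : ∀ n, KerIsSummand B (d' n)) (f₀ : X 0 →ₗ[R] Y 0)
    (hf₀ : LinearMap.range (f₀ ∘ₗ d 0) ≤ LinearMap.range (d' 0)) :
    ∃ f : ∀ n, X n →ₗ[R] Y n, f 0 = f₀ ∧ ∀ n, d' n ∘ₗ f (n + 1) = f n ∘ₗ d n := by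
  -- The range condition is the invariant of the recursion: it permits the next lift and is
  -- reproduced by it, because `d' ∘ f' ∘ d = f ∘ d ∘ d = 0`.
  have step : ∀ n (f : X n →ₗ[R] Y n), LinearMap.range (f ∘ₗ d n) ≤ LinearMap.range (d' n) →
      ∃ f' : X (n + 1) →ₗ[R] Y (n + 1), d' n ∘ₗ f' = f ∘ₗ d n ∧
        LinearMap.range (f' ∘ₗ d (n + 1)) ≤ LinearMap.range (d' (n + 1)) := by
    intro n f hf
    obtain ⟨f', hf'⟩ := hX n (d' n) (hs n) (f ∘ₗ d n) hf
    refine ⟨f', hf', ?_⟩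
    rw [hd', LinearMap.range_le_ker_iff, ← LinearMap.comp_assoc, hf', LinearMap.comp_assoc, hd,
      LinearMap.comp_zero]
  choose F hF hF' using step
  let f : ∀ n, {f : X n →ₗ[R] Y n // LinearMap.range (f ∘ₗ d n) ≤ LinearMap.range (d' n)} :=
    fun n => Nat.rec ⟨f₀, hf₀⟩ (fun n f => ⟨F n f.1 f.2, hF' n f.1 f.2⟩) n
  exact ⟨fun n => (f n).1, rfl, fun n => hF n (f n).1 (f n).2⟩

/-- A morphism of complexes that lifts the zero map is null-homotopic. -/
lemma exists_homotopy (hX : ∀ n, RelLifts B (X n) (Y (n + 1)) (Y n))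
    (hd : ∀ n, d n ∘ₗ d (n + 1) = 0) (hd' : ∀ n, LinearMap.range (d' (n + 1)) = LinearMap.ker (d' n))
    (hs : ∀ n, KerIsSummand B (d' n)) (h : ∀ n, X n →ₗ[R] Y n)
    (hh : ∀ n, d' n ∘ₗ h (n + 1) = h n ∘ₗ d n)
    (h₀ : LinearMap.range (h 0) ≤ LinearMap.range (d' 0)) :
    ∃ s : ∀ n, X n →ₗ[R] Y (n + 1), h 0 = d' 0 ∘ₗ s 0 ∧
      ∀ n, h (n + 1) = d' (n + 1) ∘ₗ s (n + 1) + s n ∘ₗ d n := by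
  obtain ⟨s₀, hs₀⟩ := hX 0 (d' 0) (hs 0) (h 0) h₀
  -- The invariant says that `h (n + 1) - s ∘ d` takes values in the kernel of `d' n`, which by
  -- exactness is the range of the next differential. It persists because the new error is `s ∘ d`,
  -- which vanishes after composing with `d`.
  have step : ∀ n (s : X n →ₗ[R] Y (n + 1)), (h n - d' n ∘ₗ s) ∘ₗ d n = 0 →
      ∃ s' : X (n + 1) →ₗ[R] Y (n + 2), d' (n + 1) ∘ₗ s' = h (n + 1) - s ∘ₗ d n ∧
        (h (n + 1) - d' (n + 1) ∘ₗ s') ∘ₗ d (n + 1) = 0 := by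
    intro n s hsn
    obtain ⟨s', hs'⟩ := hX (n + 1) (d' (n + 1)) (hs (n + 1)) (h (n + 1) - s ∘ₗ d n) (by
      rw [hd', LinearMap.range_le_ker_iff, LinearMap.comp_sub, hh, ← LinearMap.comp_assoc,
        ← LinearMap.sub_comp, hsn])
    refine ⟨s', hs', ?_⟩
    rw [hs', sub_sub_cancel, LinearMap.comp_assoc, hd, LinearMap.comp_zero]
  choose S hS hS' using step
  let s : ∀ n, {s : X n →ₗ[R] Y (n + 1) // (h n - d' n ∘ₗ s) ∘ₗ d n = 0} :=
    fun n => Nat.rec ⟨s₀, by rw [hs₀, sub_self, LinearMap.zero_comp]⟩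
      (fun n s => ⟨S n s.1 s.2, hS' n s.1 s.2⟩) n
  refine ⟨fun n => (s n).1, hs₀.symm, fun n => ?_⟩
  rw [eq_comm, ← eq_sub_iff_add_eq]
  exact hS n (s n).1 (s n).2

end Comparison

namespace RelProjResolution

variable {X : Type uX} [AddCommGroup X] [Module R X]

lemma d_comp_d (P : RelProjResolution.{u, uR, uX, w} B X) (n : ℕ) : P.d n ∘ₗ P.d (n + 1) = 0 :=
  LinearMap.range_le_ker_iff.1 (P.exact_d n).le

lemma ε_comp_d (P : RelProjResolution.{u, uR, uX, w} B X) : P.ε ∘ₗ P.d 0 = 0 :=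
  LinearMap.range_le_ker_iff.1 P.exact_ε.le

/-- Two relative projective resolutions are related by a morphism of complexes over `X`. -/
lemma exists_hom (P : RelProjResolution.{u, uR, uX, v} B X)
    (Q : RelProjResolution.{u, uR, uX, w} B X)
    (h₀ : RelLifts B (P.P 0) (Q.P 0) X)
    (h : ∀ n, RelLifts B (P.P (n + 1)) (Q.P (n + 1)) (Q.P n)) :
    ∃ f : ∀ n, P.P n →ₗ[R] Q.P n, Q.ε ∘ₗ f 0 = P.ε ∧ ∀ n, Q.d n ∘ₗ f (n + 1) = f n ∘ₗ P.d n := by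
  obtain ⟨f₀, hf₀⟩ := h₀ Q.ε Q.summand_ε P.ε
    (by rw [LinearMap.range_eq_top.2 Q.surjective_ε]; exact le_top)
  obtain ⟨f, rfl, hf⟩ := exists_chainMap (d := P.d) h P.d_comp_d Q.exact_d Q.summand_d f₀ (by
    rw [Q.exact_ε, LinearMap.range_le_ker_iff, ← LinearMap.comp_assoc, hf₀, P.ε_comp_d])
  exact ⟨f, hf₀, hf⟩

section Hom

variable (N : Type uM) [AddCommGroup N] [Module k N] [Module R N] [IsScalarTower k R N]

/-- An endomorphism of a relative projective resolution over `X` acts on relative cocycles by the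
identity, modulo coboundaries. -/
lemma comp_sub_mem_coboundaries (P : RelProjResolution.{u, uR, uX, w} B X)
    (h : ∀ n, RelLifts B (P.P n) (P.P (n + 1)) (P.P n)) (f : ∀ n, P.P n →ₗ[R] P.P n)
    (hε : P.ε ∘ₗ f 0 = P.ε) (hf : ∀ n, P.d n ∘ₗ f (n + 1) = f n ∘ₗ P.d n) (n : ℕ)
    (φ : P.P n →ₗ[R] N) (hφ : φ ∘ₗ P.d n = 0) :
    φ ∘ₗ f n - φ ∈ coboundaries (k := k) (X := fun n => P.P n →ₗ[R] N)
      (fun n => LinearMap.lcomp k N (P.d n)) n := by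
  obtain ⟨s, hs₀, hs⟩ := exists_homotopy (d := P.d) h P.d_comp_d P.exact_d P.summand_d
    (fun n => f n - LinearMap.id)
    (fun n => by rw [LinearMap.comp_sub, hf, LinearMap.sub_comp]; rfl)
    (by rw [P.exact_ε, LinearMap.range_le_ker_iff, LinearMap.comp_sub, hε]; simp)
  have key : φ ∘ₗ f n - φ = φ ∘ₗ (f n - LinearMap.id) := by
    rw [LinearMap.comp_sub, LinearMap.comp_id]
  rw [key]
  cases n with
  | zero =>
    rw [hs₀, ← LinearMap.comp_assoc, hφ, LinearMap.zero_comp]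
    exact Submodule.zero_mem _
  | succ n =>
    rw [hs, LinearMap.comp_add, ← LinearMap.comp_assoc, hφ, LinearMap.zero_comp, zero_add]
    exact ⟨φ ∘ₗ s n, rfl⟩

/-- The relative `Ext` does not depend on the relative projective resolution. -/
lemma nonempty_relExt_equiv {R : Type (max uR uX v)} [Ring R] [Algebra k R] {B : Subalgebra k R}
    {X : Type uX} [AddCommGroup X] [Module R X] (N : Type uM) [AddCommGroup N] [Module k N]
    [Module R N] [IsScalarTower k R N] (Q : RelProjResolution.{u, max uR uX v, uX, v} B X)
    (hQ : ∀ (n : ℕ) (L N : Type w) [AddCommGroup L] [Module R L] [AddCommGroup N] [Module R N],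
      RelLifts B (Q.P n) L N)
    (hQX : ∀ (L : Type w) [AddCommGroup L] [Module R L], RelLifts B (Q.P 0) L X)
    (P : RelProjResolution.{u, max uR uX v, uX, w} B X) (n : ℕ) :
    Nonempty (RelExt Q N n ≃ₗ[k] RelExt P N n) := by
  -- The terms of `P` may lie in a larger universe than the one in which the projectivity of `Q` is
  -- tested, so this direction uses `hQ` and `hQX`. In the other direction the test universe of `P`
  -- contains those of `X` and of the terms of `Q`, because `R` lives in `max uR uX v`.
  obtain ⟨f, hf₀, hf⟩ := exists_hom Q P (hQX _) fun n => hQ _ _ _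
  obtain ⟨g, hg₀, hg⟩ := exists_hom P Q
    (RelLifts.of_uLift.{u, max uR uX v, max uR uX v w, max uR uX v w, v, uX, w}
      ((P.isRelProjective 0).relLifts _ _))
    fun n => RelLifts.of_uLift.{u, max uR uX v, max uR uX v w, max uR uX v w, v, v, w}
      ((P.isRelProjective _).relLifts _ _)
  have hPP : ∀ n, RelLifts B (P.P n) (P.P (n + 1)) (P.P n) := fun n =>
    RelLifts.of_uLift.{u, max uR uX v, max uR uX v w, max uR uX v w, w, w, w}
      ((P.isRelProjective n).relLifts _ _)
  have hQQ : ∀ n, RelLifts B (Q.P n) (Q.P (n + 1)) (Q.P n) := fun n =>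
    RelLifts.of_uLift.{u, max uR uX v, max uR uX v, max uR uX v, v, v, v}
      ((Q.isRelProjective n).relLifts _ _)
  refine ⟨LinearEquiv.ofBijective _ (Cohomology.map_bijective
    (X := fun n => Q.P n →ₗ[R] N) (Y := fun n => P.P n →ₗ[R] N)
    (fun n => LinearMap.lcomp k N (g n)) ?_ (fun n => LinearMap.lcomp k N (f n)) ?_ n ?_ ?_)⟩
  · intro n φ
    exact (congrArg (φ ∘ₗ ·) (hg n))
  · intro n φ
    exact (congrArg (φ ∘ₗ ·) (hf n))
  · intro φ hφ
    refine comp_sub_mem_coboundaries N Q hQQ (fun n => g n ∘ₗ f n) ?_ (fun n => ?_) n φ hφ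
    · rw [← LinearMap.comp_assoc, hg₀, hf₀]
    · rw [← LinearMap.comp_assoc, hg, LinearMap.comp_assoc, hf, LinearMap.comp_assoc]
  · intro φ hφ
    refine comp_sub_mem_coboundaries N P hPP (fun n => f n ∘ₗ g n) ?_ (fun n => ?_) n φ hφ
    · rw [← LinearMap.comp_assoc, hf₀, hg₀]
    · rw [← LinearMap.comp_assoc, hf, LinearMap.comp_assoc, hg, LinearMap.comp_assoc]

end Hom

end RelProjResolution

end Relative

/-! ### Induced bimodules -/

noncomputable section Induced

variable {k : Type u} [Field k] {Γ : Type uG} [Group Γ] {V : Type v} [AddCommGroup V] [Module k V]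

/-- The bimodule `A ⊗ V ⊗ A` induced by a representation `V` of `Γ`. -/
def InducedBimodule (_ρ : Representation k Γ V) (A : Type uA) [Ring A] [Algebra k A] :
    Type (max uA v) := A ⊗[k] (V ⊗[k] A)

namespace InducedBimodule

variable (ρ : Representation k Γ V) (A : Type uA) [Ring A] [Algebra k A]

instance : AddCommGroup (InducedBimodule ρ A) := inferInstanceAs (AddCommGroup (A ⊗[k] (V ⊗[k] A)))

instance : Module k (InducedBimodule ρ A) := inferInstanceAs (Module k (A ⊗[k] (V ⊗[k] A)))

instance : Module A (InducedBimodule ρ A) := inferInstanceAs (Module A (A ⊗[k] (V ⊗[k] A)))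

instance : IsScalarTower k A (InducedBimodule ρ A) :=
  inferInstanceAs (IsScalarTower k A (A ⊗[k] (V ⊗[k] A)))

variable {A}

/-- The element `a ⊗ v ⊗ b` of the induced bimodule. -/
def of (a : A) (v : V) (b : A) : InducedBimodule ρ A := a ⊗ₜ[k] (v ⊗ₜ[k] b)

variable {ρ}

@[elab_as_elim]
lemma induction {p : InducedBimodule ρ A → Prop} (hof : ∀ a v b, p (of ρ a v b))
    (hadd : ∀ x y, p x → p y → p (x + y)) (x : InducedBimodule ρ A) : p x := by
  have h0 : p 0 := by
    have h := hof (0 : A) (0 : V) (0 : A)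
    rwa [show of ρ (0 : A) (0 : V) (0 : A) = 0 from TensorProduct.zero_tmul _ _] at h
  induction x using TensorProduct.induction_on with
  | zero => exact h0
  | add x y hx hy => exact hadd x y hx hy
  | tmul a x =>
    induction x using TensorProduct.induction_on with
    | zero => rw [TensorProduct.tmul_zero]; exact h0
    | add x y hx hy => rw [TensorProduct.tmul_add]; exact hadd _ _ hx hy
    | tmul v b => exact hof a v b

lemma of_add_left (a a' : A) (v : V) (b : A) : of ρ (a + a') v b = of ρ a v b + of ρ a' v b :=
  TensorProduct.add_tmul _ _ _

lemma of_add_mid (a : A) (v v' : V) (b : A) : of ρ a (v + v') b = of ρ a v b + of ρ a v' b := by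
  simp only [of, TensorProduct.add_tmul, TensorProduct.tmul_add]; rfl

lemma of_add_right (a : A) (v : V) (b b' : A) : of ρ a v (b + b') = of ρ a v b + of ρ a v b' := by
  simp only [of, TensorProduct.tmul_add]; rfl

lemma of_smul_left (c : k) (a : A) (v : V) (b : A) : of ρ (c • a) v b = c • of ρ a v b := rfl

lemma of_smul_mid (c : k) (a : A) (v : V) (b : A) : of ρ a (c • v) b = c • of ρ a v b := by
  simp only [of, ← TensorProduct.smul_tmul', TensorProduct.tmul_smul]; rfl

lemma of_smul_right (c : k) (a : A) (v : V) (b : A) : of ρ a v (c • b) = c • of ρ a v b := by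
  simp only [of, TensorProduct.tmul_smul]; rfl

variable (ρ) in
/-- The map `a ⊗ v ⊗ b ↦ f a v b`. -/
def lift {W : Type*} [AddCommGroup W] [Module k W] (f : A →ₗ[k] V →ₗ[k] A →ₗ[k] W) :
    InducedBimodule ρ A →ₗ[k] W :=
  TensorProduct.lift (TensorProduct.uncurry (.id k) V A W ∘ₗ f)

@[simp]
lemma lift_of {W : Type*} [AddCommGroup W] [Module k W] (f : A →ₗ[k] V →ₗ[k] A →ₗ[k] W)
    (a : A) (v : V) (b : A) : lift ρ f (of ρ a v b) = f a v b := rfl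

variable (ρ) in
/-- The map `v ↦ a ⊗ v ⊗ b`. -/
def ofMid (a b : A) : V →ₗ[k] InducedBimodule ρ A where
  toFun v := of ρ a v b
  map_add' v v' := of_add_mid a v v' b
  map_smul' c v := of_smul_mid c a v b

@[simp]
lemma ofMid_apply (a : A) (v : V) (b : A) : ofMid ρ a b v = of ρ a v b := rfl

@[simp]
lemma smul_of (a c : A) (v : V) (d : A) : a • of ρ c v d = of ρ (a * c) v d := rfl

variable (ρ) in
/-- Right multiplication by an element of `A`. -/
def mulRight (b : A) : InducedBimodule ρ A →ₗ[k] InducedBimodule ρ A :=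
  LinearMap.lTensor A (LinearMap.lTensor V (LinearMap.mulRight k b))

lemma mulRight_of (b c : A) (v : V) (d : A) : mulRight ρ b (of ρ c v d) = of ρ c v (d * b) := rfl

instance : Module Aᵐᵒᵖ (InducedBimodule ρ A) where
  smul b x := mulRight ρ b.unop x
  one_smul x := by
    change mulRight ρ 1 x = x
    induction x using induction with
    | hof a v b => rw [mulRight_of, mul_one]
    | hadd x y hx hy => rw [map_add, hx, hy]
  mul_smul b c x := by
    change mulRight ρ (c.unop * b.unop) x = mulRight ρ b.unop (mulRight ρ c.unop x)
    induction x using induction with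
    | hof a v b => simp only [mulRight_of, mul_assoc]
    | hadd x y hx hy => simp only [map_add, hx, hy]
  smul_zero b := map_zero _
  smul_add b := map_add _
  add_smul b c x := by
    change mulRight ρ (b.unop + c.unop) x = mulRight ρ b.unop x + mulRight ρ c.unop x
    induction x using induction with
    | hof a v b => simp only [mulRight_of, mul_add, of_add_right]
    | hadd x y hx hy => simp only [map_add, hx, hy]; abel
  zero_smul x := by
    change mulRight ρ 0 x = 0
    induction x using induction with
    | hof a v b => simpa only [mulRight_of, mul_zero, zero_smul] using of_smul_right (0 : k) a v 0
    | hadd x y hx hy => rw [map_add, hx, hy, add_zero]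

@[simp]
lemma op_smul_of (b c : A) (v : V) (d : A) : op b • of ρ c v d = of ρ c v (d * b) := rfl

instance : SMulCommClass A Aᵐᵒᵖ (InducedBimodule ρ A) where
  smul_comm a b x := by
    induction b using MulOpposite.rec' with | _ b
    induction x using induction with
    | hof c v d => simp
    | hadd x y hx hy => simp only [smul_add, hx, hy]

instance : IsScalarTower k Aᵐᵒᵖ (InducedBimodule ρ A) where
  smul_assoc c b x := by
    induction b using MulOpposite.rec' with | _ b
    induction x using induction with
    | hof a v d => rw [← op_smul, op_smul_of, op_smul_of, mul_smul_comm, of_smul_right]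
    | hadd x y hx hy => simp only [smul_add, hx, hy]

variable [MulSemiringAction Γ A] [SMulCommClass Γ k A]

variable (ρ) in
/-- The diagonal action of an element of `Γ`. -/
def act (σ : Γ) : InducedBimodule ρ A →ₗ[k] InducedBimodule ρ A :=
  TensorProduct.map (DistribSMul.toLinearMap k A σ)
    (TensorProduct.map (ρ σ) (DistribSMul.toLinearMap k A σ))

lemma act_of (σ : Γ) (a : A) (v : V) (b : A) :
    act ρ σ (of ρ a v b) = of ρ (σ • a) (ρ σ v) (σ • b) := rfl

instance : DistribMulAction Γ (InducedBimodule ρ A) where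
  smul σ x := act ρ σ x
  one_smul x := by
    change act ρ 1 x = x
    induction x using induction with
    | hof a v b => simp [act_of]
    | hadd x y hx hy => rw [map_add, hx, hy]
  mul_smul σ τ x := by
    change act ρ (σ * τ) x = act ρ σ (act ρ τ x)
    induction x using induction with
    | hof a v b => simp [act_of, mul_smul]
    | hadd x y hx hy => rw [map_add, hx, hy, map_add, map_add]
  smul_zero σ := map_zero _
  smul_add σ := map_add _

@[simp]
lemma group_smul_of (σ : Γ) (a : A) (v : V) (b : A) :
    σ • of ρ a v b = of ρ (σ • a) (ρ σ v) (σ • b) := rfl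

instance : SMulCommClass Γ k (InducedBimodule ρ A) where
  smul_comm σ c x := map_smul (act ρ σ) c x

instance : IsEquivariantBimodule Γ A (InducedBimodule ρ A) where
  smul_left σ a x := by
    induction x using induction with
    | hof c v d => simp [smul_mul']
    | hadd x y hx hy => simp only [smul_add, hx, hy]
  smul_right σ a x := by
    induction x using induction with
    | hof c v d => simp [smul_mul', -op_smul]
    | hadd x y hx hy => simp only [smul_add, hx, hy]

lemma env_smul_of (a b : A) (σ : Γ) (c : A) (v : V) (d : A) :
    EquivEnv.of k a σ b • of ρ c v d = of ρ (a * σ • c) (ρ σ v) (σ • d * b) := by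
  simp [EquivEnv.of_smul]

section Extend

variable {N : Type w} [AddCommGroup N] [Module k N] [Module (EquivEnv k Γ A) N]
  [IsScalarTower k (EquivEnv k Γ A) N]

variable (ρ) in
/-- The linear map `a ⊗ v ⊗ b ↦ (a ⊗ 1 ⊗ b) φ v`. -/
def extendₗ (φ : V →ₗ[k] N) : InducedBimodule ρ A →ₗ[k] N :=
  lift ρ
    { toFun := fun a => LinearMap.mk₂ k (fun v b => EquivEnv.of k a (1 : Γ) b • φ v)
        (by intros; rw [map_add, smul_add])
        (by intros; rw [map_smul, smul_comm])
        (by intros; rw [EquivEnv.of_add_right, add_smul])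
        (by intros; rw [EquivEnv.of_smul_right, smul_assoc])
      map_add' := fun a a' => by ext; simp [EquivEnv.of_add_left, add_smul]
      map_smul' := fun c a => by ext; simp [EquivEnv.of_smul_left, smul_assoc] }

/-- A homomorphism of representations of `Γ` from `V` to an `(A, Γ)ᵉ`-module extends to the
induced bimodule. -/
def extend (φ : V →ₗ[k] N) (hφ : ∀ σ v, φ (ρ σ v) = EquivEnv.of k (1 : A) σ 1 • φ v) :
    InducedBimodule ρ A →ₗ[EquivEnv k Γ A] N where
  __ := extendₗ ρ φ
  map_smul' x y := by
    change extendₗ ρ φ (x • y) = x • extendₗ ρ φ y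
    induction x using EquivEnv.induction with
    | hadd x x' hx hx' => simp only [add_smul, map_add, hx, hx']
    | hof a σ b =>
    induction y using induction with
    | hadd y y' hy hy' => simp only [smul_add, map_add, hy, hy']
    | hof c v d =>
      rw [env_smul_of]
      simp only [extendₗ, lift_of, LinearMap.coe_mk, AddHom.coe_mk, LinearMap.mk₂_apply, hφ,
        smul_smul, EquivEnv.of_mul_of]
      simp

lemma extend_of (φ : V →ₗ[k] N) (hφ : ∀ σ v, φ (ρ σ v) = EquivEnv.of k (1 : A) σ 1 • φ v)
    (a : A) (v : V) (b : A) : extend φ hφ (of ρ a v b) = EquivEnv.of k a (1 : Γ) b • φ v := rfl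

/-- The elements `1 ⊗ v ⊗ 1` generate the module. This is the uniqueness half of Frobenius
reciprocity, `extend` being the existence half. -/
lemma hom_ext {f g : InducedBimodule ρ A →ₗ[EquivEnv k Γ A] N}
    (h : ∀ v, f (of ρ 1 v 1) = g (of ρ 1 v 1)) : f = g := by
  ext x
  induction x using induction with
  | hadd x y hx hy => rw [map_add, map_add, hx, hy]
  | hof a v b =>
    have : of ρ a v b = EquivEnv.of k a (1 : Γ) b • of ρ 1 v 1 := by simp [env_smul_of]
    rw [this, map_smul, map_smul, h]

end Extend

lemma groupSubalgebra_mem (σ : Γ) : EquivEnv.of k (1 : A) σ 1 ∈ EquivEnv.groupSubalgebra k Γ A :=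
  ⟨MonoidAlgebra.single σ 1, by simp [EquivEnv.groupAlgHom]⟩

/-- Induced bimodules are relatively projective. -/
lemma relLifts (L : Type uX) (N : Type w) [AddCommGroup L] [Module (EquivEnv k Γ A) L]
    [AddCommGroup N] [Module (EquivEnv k Γ A) N] :
    RelLifts (EquivEnv.groupSubalgebra k Γ A) (InducedBimodule ρ A) L N := by
  intro π hπ g hg
  -- The test modules carry only an action of `(A, Γ)ᵉ`; their `k`-structure is recovered through
  -- its scalars, so that `extend` applies.
  let _ : Module k L := Module.compHom L (algebraMap k (EquivEnv k Γ A))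
  have : IsScalarTower k (EquivEnv k Γ A) L := IsScalarTower.of_algebraMap_smul fun _ _ => rfl
  let _ : Module k N := Module.compHom N (algebraMap k (EquivEnv k Γ A))
  have : IsScalarTower k (EquivEnv k Γ A) N := IsScalarTower.of_algebraMap_smul fun _ _ => rfl
  -- By Frobenius reciprocity only the `kΓ`-linear map `v ↦ g (1 ⊗ v ⊗ 1)` has to be lifted, and
  -- over `kΓ` the map `π` splits on its range.
  obtain ⟨t, hπt, hadd, hsmul⟩ := hπ.exists_lift (fun v => g (of ρ 1 v 1)) fun v => hg ⟨_, rfl⟩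
  let φ : V →ₗ[k] L :=
    { toFun := t
      map_add' := fun v v' => hadd _ _ _ (by rw [of_add_mid, map_add])
      map_smul' := fun c v => hsmul (algebraMap k _ c) (Subalgebra.algebraMap_mem _ c) _ _
        (by rw [of_smul_mid, ← map_smul, algebraMap_smul]) }
  have hφ : ∀ σ v, φ (ρ σ v) = EquivEnv.of k (1 : A) σ 1 • φ v := fun σ v =>
    hsmul _ (groupSubalgebra_mem σ) _ _ (by rw [← map_smul, env_smul_of]; simp)
  refine ⟨extend φ hφ, hom_ext fun v => ?_⟩
  rw [LinearMap.comp_apply, extend_of, ← EquivEnv.one_def, one_smul]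
  exact hπt v

end InducedBimodule

end Induced

/-! ### Equivariant splittings as splittings over the group algebra -/

section GroupSubalgebra

variable {k : Type u} [Field k] {Γ : Type uG} [Group Γ] {A : Type uA} [Ring A] [Algebra k A]
  [MulSemiringAction Γ A] [SMulCommClass Γ k A]
  {M : Type v} [AddCommGroup M] [Module k M] [Module A M] [Module Aᵐᵒᵖ M]
  [SMulCommClass A Aᵐᵒᵖ M] [IsScalarTower k A M] [IsScalarTower k Aᵐᵒᵖ M]
  [DistribMulAction Γ M] [SMulCommClass Γ k M] [IsEquivariantBimodule Γ A M]
  {N : Type w} [AddCommGroup N] [Module k N] [Module A N] [Module Aᵐᵒᵖ N]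
  [SMulCommClass A Aᵐᵒᵖ N] [IsScalarTower k A N] [IsScalarTower k Aᵐᵒᵖ N]
  [DistribMulAction Γ N] [SMulCommClass Γ k N] [IsEquivariantBimodule Γ A N]

/-- A `Γ`-equivariant linear map is linear over the group algebra. -/
def LinearMap.toGroupSubalgebra (f : M →ₗ[k] N) (hf : ∀ (σ : Γ) x, f (σ • x) = σ • f x) :
    M →ₗ[EquivEnv.groupSubalgebra k Γ A] N where
  __ := f
  map_smul' := by
    rintro ⟨_, y, rfl⟩ x
    change f (EquivEnv.groupAlgHom k Γ A y • x) = EquivEnv.groupAlgHom k Γ A y • f x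
    induction y using MonoidAlgebra.induction_linear with
    | zero => simp
    | add y y' hy hy' => simp only [map_add, add_smul, hy, hy']
    | single σ c => simp [EquivEnv.groupAlgHom, EquivEnv.of_smul, smul_assoc, hf]

/-- The subalgebra `kΓ` is spanned by the group elements, so an equivariant contracting homotopy
already provides the splitting required of a relative resolution. -/
lemma KerIsSummand.of_equivariant {f : M →ₗ[EquivEnv k Γ A] N} (s : N →ₗ[k] M)
    (hs : ∀ (σ : Γ) x, s (σ • x) = σ • s x) (h : ∀ x, f (s (f x)) = f x) :
    KerIsSummand (EquivEnv.groupSubalgebra k Γ A) f :=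
  KerIsSummand.of_section f (s.toGroupSubalgebra hs) h

end GroupSubalgebra

/-! ### The equivariant bar resolution -/

noncomputable section Bar

variable (k : Type u) [Field k] (Γ : Type uG) [Group Γ] (A : Type uA) [Ring A] [Algebra k A]
  [MulSemiringAction Γ A] [SMulCommClass Γ k A]

/-- The diagonal action of `Γ` on `A ⊗ ⋯ ⊗ A`. -/
def tensorRep (n : ℕ) : Representation k Γ (⨂[k] _ : Fin n, A) where
  toFun σ := PiTensorProduct.map fun _ => DistribSMul.toLinearMap k A σ
  map_one' := by ext; simp
  map_mul' σ τ := by ext; simp [mul_smul]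

lemma tensorRep_tprod (n : ℕ) (σ : Γ) (a : Fin n → A) :
    tensorRep k Γ A n σ (PiTensorProduct.tprod k a) = PiTensorProduct.tprod k fun i => σ • a i := by
  simp [tensorRep]

/-- The bimodule `A ⊗ (A ⊗ ⋯ ⊗ A) ⊗ A` of the bar resolution in degree `n`. -/
abbrev Bar (n : ℕ) : Type (max u uA) := InducedBimodule (tensorRep k Γ A n) A

namespace Bar

variable {A} in
/-- The element `a ⊗ (v₁ ⊗ ⋯ ⊗ vₙ) ⊗ b` of the bar resolution. -/
def of {n : ℕ} (a : A) (v : Fin n → A) (b : A) : Bar k Γ A n :=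
  InducedBimodule.of _ a (PiTensorProduct.tprod k v) b

variable {k Γ A}

@[elab_as_elim]
lemma induction {n : ℕ} {p : Bar k Γ A n → Prop} (hof : ∀ a v b, p (of k Γ a v b))
    (hadd : ∀ x y, p x → p y → p (x + y)) (x : Bar k Γ A n) : p x := by
  induction x using InducedBimodule.induction with
  | hadd x y hx hy => exact hadd x y hx hy
  | hof a v b =>
    induction v using PiTensorProduct.induction_on with
    | smul_tprod c v =>
      rw [InducedBimodule.of_smul_mid, ← InducedBimodule.of_smul_left]
      exact hof _ _ _
    | add v w hv hw =>
      rw [InducedBimodule.of_add_mid]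
      exact hadd _ _ hv hw

@[simp]
lemma smul_of {n : ℕ} (a c : A) (v : Fin n → A) (b : A) : a • of k Γ c v b = of k Γ (a * c) v b :=
  rfl

@[simp]
lemma op_smul_of {n : ℕ} (b c : A) (v : Fin n → A) (d : A) :
    op b • of k Γ c v d = of k Γ c v (d * b) :=
  rfl

lemma group_smul_of {n : ℕ} (σ : Γ) (a : A) (v : Fin n → A) (b : A) :
    σ • of k Γ a v b = of k Γ (σ • a) (fun i => σ • v i) (σ • b) := by
  rw [of, InducedBimodule.group_smul_of, tensorRep_tprod]
  rfl

variable (k Γ A) in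
/-- The universal equivariant cochain `v ↦ 1 ⊗ v ⊗ 1`. -/
def universal (n : ℕ) : HochCochain k A (Bar k Γ A n) n :=
  (InducedBimodule.ofMid _ 1 1).compMultilinearMap (PiTensorProduct.tprod k)

lemma universal_apply {n : ℕ} (v : Fin n → A) : universal k Γ A n v = of k Γ 1 v 1 := rfl

lemma universal_mem (n : ℕ) : universal k Γ A n ∈ equivariantCochains k A (Bar k Γ A n) Γ n := by
  intro σ v
  rw [universal_apply, universal_apply, group_smul_of, smul_one]

section Hom

variable {M : Type uM} [AddCommGroup M] [Module k M] [Module A M] [Module Aᵐᵒᵖ M]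
  [SMulCommClass A Aᵐᵒᵖ M] [IsScalarTower k A M] [IsScalarTower k Aᵐᵒᵖ M]
  [DistribMulAction Γ M] [SMulCommClass Γ k M] [IsEquivariantBimodule Γ A M]

/-- An equivariant cochain extends to a homomorphism of `(A, Γ)ᵉ`-modules. -/
def extend {n : ℕ} (φ : HochCochain k A M n) (hφ : φ ∈ equivariantCochains k A M Γ n) :
    Bar k Γ A n →ₗ[EquivEnv k Γ A] M :=
  InducedBimodule.extend (PiTensorProduct.lift φ) (by
    intro σ v
    induction v using PiTensorProduct.induction_on with
    | smul_tprod c v => simp [tensorRep_tprod, EquivEnv.of_smul, hφ σ v, smul_comm σ c]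
    | add v w hv hw => simp only [map_add, hv, hw, smul_add])

lemma extend_of {n : ℕ} (φ : HochCochain k A M n) (hφ : φ ∈ equivariantCochains k A M Γ n)
    (a : A) (v : Fin n → A) (b : A) : extend φ hφ (of k Γ a v b) = a • op b • φ v := by
  rw [extend, of, InducedBimodule.extend_of, EquivEnv.of_smul, one_smul, PiTensorProduct.lift.tprod]

lemma map_smul_left {N : Type v} [AddCommGroup N] [Module k N] [Module A N] [Module Aᵐᵒᵖ N]
    [SMulCommClass A Aᵐᵒᵖ N] [IsScalarTower k A N] [IsScalarTower k Aᵐᵒᵖ N]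
    [DistribMulAction Γ N] [SMulCommClass Γ k N] [IsEquivariantBimodule Γ A N]
    (f : N →ₗ[EquivEnv k Γ A] M) (a : A) (x : N) : f (a • x) = a • f x := by
  simpa [EquivEnv.of_smul] using map_smul f (EquivEnv.of k a (1 : Γ) 1) x

lemma map_smul_right {N : Type v} [AddCommGroup N] [Module k N] [Module A N] [Module Aᵐᵒᵖ N]
    [SMulCommClass A Aᵐᵒᵖ N] [IsScalarTower k A N] [IsScalarTower k Aᵐᵒᵖ N]
    [DistribMulAction Γ N] [SMulCommClass Γ k N] [IsEquivariantBimodule Γ A N]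
    (f : N →ₗ[EquivEnv k Γ A] M) (a : A) (x : N) : f (op a • x) = op a • f x := by
  simpa [EquivEnv.of_smul] using map_smul f (EquivEnv.of k (1 : A) (1 : Γ) a) x

lemma map_smul_group {N : Type v} [AddCommGroup N] [Module k N] [Module A N] [Module Aᵐᵒᵖ N]
    [SMulCommClass A Aᵐᵒᵖ N] [IsScalarTower k A N] [IsScalarTower k Aᵐᵒᵖ N]
    [DistribMulAction Γ N] [SMulCommClass Γ k N] [IsEquivariantBimodule Γ A N]
    (f : N →ₗ[EquivEnv k Γ A] M) (σ : Γ) (x : N) : f (σ • x) = σ • f x := by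
  simpa [EquivEnv.of_smul] using map_smul f (EquivEnv.of k (1 : A) σ 1) x

end Hom

variable (k Γ A) in
/-- The differential of the bar resolution. -/
def d (n : ℕ) : Bar k Γ A (n + 1) →ₗ[EquivEnv k Γ A] Bar k Γ A n :=
  -- By Yoneda the bar differential is the map classifying the Hochschild coboundary of the
  -- universal cochain. Its linearity over `(A, Γ)ᵉ` then needs no separate check.
  extend (hochDiff k A _ n (universal k Γ A n)) (hochDiff_mem Γ n _ (universal_mem n))

lemma d_of {n : ℕ} (a : A) (v : Fin (n + 1) → A) (b : A) :
    d k Γ A n (of k Γ a v b) = of k Γ (a * v 0) (fun i => v i.succ) b +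
      ∑ j : Fin n, (-1 : k) ^ ((j : ℕ) + 1) •
        of k Γ a (Fin.contractNth j.castSucc (· * ·) v) b +
      (-1 : k) ^ (n + 1) • of k Γ a (fun i => v i.castSucc) (v (Fin.last n) * b) := by
  rw [d, extend_of, hochDiff_apply]
  simp only [universal_apply, smul_of, op_smul_of, smul_add, Finset.smul_sum, mul_one, one_mul,
    smul_comm (op b) (_ : k), smul_comm a (_ : k)]

variable (k Γ A) in
/-- The augmentation `a ⊗ b ↦ a b`. -/
def ε : Bar k Γ A 0 →ₗ[EquivEnv k Γ A] A :=
  extend (MultilinearMap.constOfIsEmpty k _ 1) (fun σ a => by simp)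

lemma ε_of (a : A) (v : Fin 0 → A) (b : A) : ε k Γ A (of k Γ a v b) = a * b := by
  exact (extend_of (Γ := Γ) _ _ a v b).trans (by simp)

variable (k A) in
/-- The map `a ⊗ v ↦ (a, v)`. -/
def consTensor (n : ℕ) : A →ₗ[k] (⨂[k] _ : Fin n, A) →ₗ[k] (⨂[k] _ : Fin (n + 1), A) :=
  (PiTensorProduct.lift (R := k) (s := fun _ : Fin n => A)).toLinearMap ∘ₗ
    (PiTensorProduct.tprod k (s := fun _ : Fin (n + 1) => A)).curryLeft

variable (k Γ A) in
/-- The contracting homotopy `a ⊗ v ⊗ b ↦ 1 ⊗ (a, v) ⊗ b` of the bar resolution. -/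
def s (n : ℕ) : Bar k Γ A n →ₗ[k] Bar k Γ A (n + 1) :=
  InducedBimodule.lift _
    { toFun := fun a => LinearMap.mk₂ k
        (fun v b => InducedBimodule.of (tensorRep k Γ A (n + 1)) 1 (consTensor k A n a v) b)
        (by intros; rw [map_add, InducedBimodule.of_add_mid])
        (by intros; rw [map_smul, InducedBimodule.of_smul_mid])
        (by intros; rw [InducedBimodule.of_add_right])
        (by intros; rw [InducedBimodule.of_smul_right])
      map_add' := fun a a' => by
        apply LinearMap.ext₂
        intro v b
        simp [InducedBimodule.of_add_mid]
      map_smul' := fun c a => by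
        apply LinearMap.ext₂
        intro v b
        simp [InducedBimodule.of_smul_mid] }

lemma s_of {n : ℕ} (a : A) (v : Fin n → A) (b : A) :
    s k Γ A n (of k Γ a v b) = of k Γ 1 (Fin.cons a v) b := by
  simp [s, of, consTensor]

/-- The inserted factor `1` is fixed by `Γ`. This is the reason that the bar complex splits over
`kΓ`, and not merely over `k`. -/
lemma s_smul {n : ℕ} (σ : Γ) (x : Bar k Γ A n) : s k Γ A n (σ • x) = σ • s k Γ A n x := by
  induction x using induction with
  | hadd x y hx hy => simp only [smul_add, map_add, hx, hy]
  | hof a v b =>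
    rw [group_smul_of, s_of, s_of, group_smul_of, smul_one]
    congr 1
    funext i
    refine Fin.cases ?_ (fun i => ?_) i <;> rfl

variable (k Γ A) in
/-- The map `a ↦ 1 ⊗ a`, a section of the augmentation. -/
def section₀ : A →ₗ[k] Bar k Γ A 0 where
  toFun b := of k Γ 1 Fin.elim0 b
  map_add' _ _ := InducedBimodule.of_add_right _ _ _ _
  map_smul' _ _ := InducedBimodule.of_smul_right _ _ _ _

lemma section₀_smul (σ : Γ) (a : A) : section₀ k Γ A (σ • a) = σ • section₀ k Γ A a := by
  change of k Γ 1 _ _ = σ • of k Γ 1 _ _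
  rw [group_smul_of, smul_one]
  congr 1
  exact Subsingleton.elim _ _

lemma ε_section₀ (a : A) : ε k Γ A (section₀ k Γ A a) = a := by
  change ε k Γ A (of k Γ 1 _ a) = a
  rw [ε_of, one_mul]

lemma d_s_zero (x : Bar k Γ A 0) :
    d k Γ A 0 (s k Γ A 0 x) + section₀ k Γ A (ε k Γ A x) = x := by
  induction x using induction with
  | hadd x y hx hy =>
    simp only [map_add]
    rw [add_add_add_comm, hx, hy]
  | hof a v b =>
    rw [s_of, d_of, ε_of]
    simp only [Fin.cons_zero, one_mul, Finset.univ_eq_empty, Finset.sum_empty, add_zero, zero_add,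
      pow_one, neg_smul, one_smul]
    have h : section₀ k Γ A (a * b) = of k Γ 1 v (a * b) :=
      congrArg (fun v => of k Γ 1 v (a * b)) (Subsingleton.elim _ _)
    rw [h, Subsingleton.elim (fun i : Fin 0 => (Fin.cons a v : Fin 1 → A) i.castSucc) v]
    have : (Fin.cons a v : Fin 1 → A) (Fin.last 0) = a := rfl
    rw [this, neg_add_cancel_right]
    rfl

/-- Index bookkeeping for `d_s_succ`: only the first contraction involves the prepended entry `a`;
the later ones are contractions of `v`, shifted by one place. -/
lemma contractNth_zero_cons {n : ℕ} (a : A) (v : Fin (n + 1) → A) :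
    Fin.contractNth (Fin.castSucc 0) (· * ·) (Fin.cons a v : Fin (n + 2) → A) =
      Fin.cons (a * v 0) fun i => v i.succ := by
  funext i
  refine Fin.cases ?_ (fun i => ?_) i
  · rfl
  · rw [Fin.contractNth_apply_of_gt _ _ _ _ (by simp)]
    rfl

lemma contractNth_succ_cons {n : ℕ} (a : A) (v : Fin (n + 1) → A) (j : Fin n) :
    Fin.contractNth j.succ.castSucc (· * ·) (Fin.cons a v : Fin (n + 2) → A) =
      Fin.cons a (Fin.contractNth j.castSucc (· * ·) v) := by
  funext i
  refine Fin.cases ?_ (fun i => ?_) i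
  · rw [Fin.contractNth_apply_of_lt _ _ _ _ (by simp)]
    rfl
  · simp only [Fin.contractNth, Fin.cons_succ, Fin.val_succ, Fin.val_castSucc,
      add_lt_add_iff_right, add_left_inj, ← Fin.succ_castSucc]

/-- The leading term of `d (1 ⊗ (a, v) ⊗ b)` is `a ⊗ v ⊗ b`. Each other term is `s` of a term of `d
(a ⊗ v ⊗ b)` with its index raised by one, hence with the opposite sign. -/
lemma d_s_succ (n : ℕ) (x : Bar k Γ A (n + 1)) :
    d k Γ A (n + 1) (s k Γ A (n + 1) x) + s k Γ A n (d k Γ A n x) = x := by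
  induction x using induction with
  | hadd x y hx hy =>
    simp only [map_add]
    rw [add_add_add_comm, hx, hy]
  | hof a v b =>
    have h : (fun i : Fin (n + 1) => (Fin.cons a v : Fin (n + 2) → A) i.castSucc) =
        Fin.cons a fun i : Fin n => v i.castSucc := by
      funext i
      refine Fin.cases ?_ (fun i => ?_) i
      · rfl
      · rw [← Fin.succ_castSucc]; rfl
    have h' : (Fin.cons a v : Fin (n + 2) → A) (Fin.last (n + 1)) = v (Fin.last n) := rfl
    rw [s_of, d_of, d_of, Fin.sum_univ_succ, contractNth_zero_cons, h, h']
    simp only [contractNth_succ_cons, map_add, map_sum, map_smul, s_of, Fin.cons_zero, Fin.cons_succ,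
      Fin.val_zero, Fin.val_succ, pow_succ _ (_ + 1), mul_neg, mul_one, neg_smul,
      Finset.sum_neg_distrib, zero_add, pow_one, one_smul, one_mul]
    abel

lemma ε_d (x : Bar k Γ A 1) : ε k Γ A (d k Γ A 0 x) = 0 := by
  induction x using induction with
  | hadd x y hx hy => simp only [map_add, hx, hy, add_zero]
  | hof a v b =>
    rw [d_of]
    simp [ε_of, mul_assoc]

/-- The homotopy identity replaces the cancellation of signed sums. The image of `s` generates the
bar module over `A` from the left, so `d d s = 0` suffices (`key`); and `d d s = d - d s d`, where
`d s d = d` by the identity one degree lower and induction, starting from `ε d = 0`. -/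
lemma d_d (n : ℕ) (x : Bar k Γ A (n + 2)) : d k Γ A n (d k Γ A (n + 1) x) = 0 := by
  have key : ∀ n, (∀ x : Bar k Γ A (n + 1), d k Γ A n (d k Γ A (n + 1) (s k Γ A (n + 1) x)) = 0) →
      ∀ x, d k Γ A n (d k Γ A (n + 1) x) = 0 := by
    intro n h x
    induction x using induction with
    | hadd x y hx hy => simp only [map_add, hx, hy, add_zero]
    | hof a v b =>
      have : of k Γ a v b = a • s k Γ A (n + 1) (of k Γ (v 0) (fun i => v i.succ) b) := by
        rw [s_of, smul_of, mul_one]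
        congr 1
        exact (Fin.cons_self_tail v).symm
      rw [this, map_smul_left, map_smul_left, h, smul_zero]
  induction n with
  | zero =>
    refine key 0 (fun x => ?_) x
    rw [eq_sub_of_add_eq (d_s_succ 0 x), map_sub]
    have := d_s_zero (d k Γ A 0 x)
    rw [ε_d, map_zero, add_zero] at this
    rw [this, sub_self]
  | succ n ih =>
    refine key (n + 1) (fun x => ?_) x
    rw [eq_sub_of_add_eq (d_s_succ (n + 1) x), map_sub]
    have := d_s_succ n (d k Γ A (n + 1) x)
    rw [ih, map_zero, add_zero] at this
    rw [this, sub_self]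

variable (k Γ A) in
/-- The equivariant bar resolution. -/
def resolution :
    RelProjResolution.{u, max u uG uA, uA, max u uA} (EquivEnv.groupSubalgebra k Γ A) A where
  P := Bar k Γ A
  d := d k Γ A
  ε := ε k Γ A
  isRelProjective n := IsRelProjective.of_relLifts fun L N => InducedBimodule.relLifts L N
  surjective_ε a := ⟨_, ε_section₀ a⟩
  exact_ε := by
    refine le_antisymm (LinearMap.range_le_ker_iff.2 (LinearMap.ext ε_d)) fun x hx => ?_
    have := d_s_zero x
    rw [LinearMap.mem_ker.1 hx, map_zero, add_zero] at this
    exact ⟨_, this⟩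
  exact_d n := by
    refine le_antisymm (LinearMap.range_le_ker_iff.2 (LinearMap.ext (d_d n))) fun x hx => ?_
    have := d_s_succ n x
    rw [LinearMap.mem_ker.1 hx, map_zero, add_zero] at this
    exact ⟨_, this⟩
  summand_ε := KerIsSummand.of_equivariant (section₀ k Γ A) section₀_smul
    fun x => ε_section₀ _
  -- The homotopy identity applied to `d x` gives `d s d = d`, since the remaining term contains `d
  -- d` or, in degree `0`, `ε d`.
  summand_d n := KerIsSummand.of_equivariant (s k Γ A n) s_smul fun x => by
    cases n with
    | zero => simpa only [ε_d, map_zero, add_zero] using d_s_zero (d k Γ A 0 x)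
    | succ n => simpa only [d_d, map_zero, add_zero] using d_s_succ n (d k Γ A (n + 1) x)

/-! ### Equivariant cochains as homomorphisms from the bar resolution -/

section Ext

variable (M : Type uM) [AddCommGroup M] [Module k M] [Module A M] [Module Aᵐᵒᵖ M]
  [SMulCommClass A Aᵐᵒᵖ M] [IsScalarTower k A M] [IsScalarTower k Aᵐᵒᵖ M]
  [DistribMulAction Γ M] [SMulCommClass Γ k M] [IsEquivariantBimodule Γ A M]

/-- The cochain `v ↦ f (1 ⊗ v ⊗ 1)` of a homomorphism of `(A, Γ)ᵉ`-modules. -/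
def toCochain (n : ℕ) :
    (Bar k Γ A n →ₗ[EquivEnv k Γ A] M) →ₗ[k] equivariantCochains k A M Γ n where
  toFun f := ⟨(f.restrictScalars k).compMultilinearMap (universal k Γ A n), fun σ v => by
    change f (universal k Γ A n _) = σ • f (universal k Γ A n v)
    rw [universal_mem n σ v, map_smul_group]⟩
  map_add' _ _ := rfl
  map_smul' _ _ := rfl

lemma hom_ext {n : ℕ} {f g : Bar k Γ A n →ₗ[EquivEnv k Γ A] M}
    (h : ∀ v, f (of k Γ 1 v 1) = g (of k Γ 1 v 1)) : f = g := by
  ext x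
  induction x using induction with
  | hadd x y hx hy => rw [map_add, map_add, hx, hy]
  | hof a v b =>
    have : of k Γ a v b = a • op b • of k Γ 1 v 1 := by simp
    rw [this, map_smul_left, map_smul_left, map_smul_right, map_smul_right, h]

variable (k Γ A) in
/-- Equivariant cochains are the homomorphisms from the bar resolution. -/
def homEquiv (n : ℕ) :
    (Bar k Γ A n →ₗ[EquivEnv k Γ A] M) ≃ₗ[k] equivariantCochains k A M Γ n where
  __ := toCochain M n
  invFun φ := extend φ.1 φ.2
  left_inv f := hom_ext M fun v => by
    rw [extend_of, op_one, one_smul, one_smul]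
    rfl
  right_inv φ := Subtype.ext (MultilinearMap.ext fun v => by
    change extend φ.1 φ.2 (of k Γ 1 v 1) = _
    rw [extend_of, op_one, one_smul, one_smul])

/-- Since `d` classifies the coboundary of the universal cochain, this amounts to `f`, a bimodule
map, commuting with the Hochschild differential. -/
lemma homEquiv_comp_d (n : ℕ) (f : Bar k Γ A n →ₗ[EquivEnv k Γ A] M) :
    homEquiv k Γ A M (n + 1) (f ∘ₗ d k Γ A n) =
      equivariantDiff k A M Γ n (homEquiv k Γ A M n f) := by
  refine Subtype.ext (MultilinearMap.ext fun v => ?_)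
  change f (d k Γ A n (of k Γ 1 v 1)) = hochDiff k A M n (toCochain M n f).1 v
  have h : d k Γ A n (of k Γ 1 v 1) = hochDiff k A _ n (universal k Γ A n) v := by
    rw [d, extend_of, op_one, one_smul, one_smul]
  have hk : ∀ (c : k) x, f (c • x) = c • f x := fun c x => (f.restrictScalars k).map_smul c x
  rw [h, hochDiff_apply, hochDiff_apply]
  simp only [map_add, map_sum, hk, map_smul_left, map_smul_right]
  rfl

lemma nonempty_equivariantHH_equiv (n : ℕ) :
    Nonempty (EquivariantHH k A M Γ n ≃ₗ[k] RelExt (resolution k Γ A) M n) := by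
  refine ⟨(LinearEquiv.ofBijective _ (Cohomology.map_bijective
    (X := fun n => Bar k Γ A n →ₗ[EquivEnv k Γ A] M) (d := fun n => LinearMap.lcomp k M (d k Γ A n))
    (d' := equivariantDiff k A M Γ)
    (fun n => (homEquiv k Γ A M n).toLinearMap) (homEquiv_comp_d M)
    (fun n => (homEquiv k Γ A M n).symm.toLinearMap) (fun n φ => ?_) n (fun f _ => ?_)
    (fun φ _ => ?_))).symm⟩
  · have h := homEquiv_comp_d M n ((homEquiv k Γ A M n).symm φ)
    rw [LinearEquiv.apply_symm_apply] at h
    exact (homEquiv k Γ A M (n + 1)).injective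
      (((homEquiv k Γ A M (n + 1)).apply_symm_apply _).trans h.symm)
  · simp
  · simp

end Ext

end Bar

end Bar

/-! ### The skew group algebra -/

noncomputable section Skew

variable (k : Type u) [Field k] (Γ : Type uG) [Group Γ] (A : Type uA) [Ring A] [Algebra k A]
  [MulSemiringAction Γ A] [SMulCommClass Γ k A]

namespace EquivEnv

/-- The linear map `a ⊗ σ ⊗ b ↦ (a ⊗ b) ⋆ σ`. -/
def toSkewₗ : EquivEnv k Γ A →ₗ[k] SkewEnv k Γ A :=
  lift fun σ => LinearMap.mk₂ k (fun a b => SkewMonoidAlgebra.single σ (EnvAlg.of k a b))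
    (fun a a' b => (congrArg _ (TensorProduct.add_tmul a a' (op b))).trans
      (SkewMonoidAlgebra.single_add _ _ _))
    (fun c a b => (SkewMonoidAlgebra.smul_single c σ (EnvAlg.of k a b)).symm)
    (fun a b b' => (congrArg _ (TensorProduct.tmul_add a (op b) (op b'))).trans
      (SkewMonoidAlgebra.single_add _ _ _))
    (fun c a b => (congrArg _ (TensorProduct.tmul_smul c a (op b))).trans
      (SkewMonoidAlgebra.smul_single c σ (EnvAlg.of k a b)).symm)

variable {k Γ A}

lemma toSkewₗ_of (a : A) (σ : Γ) (b : A) :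
    toSkewₗ k Γ A (of k a σ b) = SkewMonoidAlgebra.single σ (EnvAlg.of k a b) := by
  rw [toSkewₗ, lift_of]
  rfl

/-- In `Aᵉ` the right factors multiply as `op b * op (σ • d) = op ((σ • d) * b)`, which is the order
built into the product of `(A, Γ)ᵉ`. -/
lemma toSkewₗ_mul (x y : EquivEnv k Γ A) :
    toSkewₗ k Γ A (x * y) = toSkewₗ k Γ A x * toSkewₗ k Γ A y := by
  induction x using induction with
  | hadd x x' hx hx' => simp only [add_mul, map_add, hx, hx']
  | hof a σ b =>
  induction y using induction with
  | hadd y y' hy hy' => simp only [mul_add, map_add, hy, hy']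
  | hof c τ d =>
    rw [of_mul_of, toSkewₗ_of, toSkewₗ_of, toSkewₗ_of, SkewMonoidAlgebra.single_mul_single,
      EnvAlg.smul_of]
    exact congrArg (SkewMonoidAlgebra.single (σ * τ))
      (Algebra.TensorProduct.tmul_mul_tmul a (σ • c) (op b) (op (σ • d))).symm

variable (k Γ A) in
/-- The additive map `(a ⊗ b) ⋆ σ ↦ a ⊗ σ ⊗ b`. -/
def ofSkew : SkewEnv k Γ A →+ EquivEnv k Γ A :=
  (Finsupp.liftAddHom fun σ => (TensorProduct.lift
    (LinearMap.mk₂ k (fun (a : A) (b : Aᵐᵒᵖ) => of k a σ b.unop)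
      (fun a a' b => of_add_left a a' σ b.unop) (fun c a b => of_smul_left c a σ b.unop)
      (fun a b b' => of_add_right a σ b.unop b'.unop)
      (fun c a b => of_smul_right c a σ b.unop))).toAddMonoidHom).comp
  SkewMonoidAlgebra.coeffAddEquiv.toAddMonoidHom

lemma ofSkew_single (σ : Γ) (a b : A) :
    ofSkew k Γ A (SkewMonoidAlgebra.single σ (EnvAlg.of k a b)) = of k a σ b :=
  Finsupp.liftAddHom_apply_single _ _ _

lemma ofSkew_toSkewₗ (x : EquivEnv k Γ A) : ofSkew k Γ A (toSkewₗ k Γ A x) = x := by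
  induction x using induction with
  | hadd x y hx hy => simp only [map_add, hx, hy]
  | hof a σ b => rw [toSkewₗ_of, ofSkew_single]

lemma toSkewₗ_ofSkew (x : SkewEnv k Γ A) : toSkewₗ k Γ A (ofSkew k Γ A x) = x := by
  induction x using SkewMonoidAlgebra.induction_on with
  | zero => simp only [map_zero]
  | add x y hx hy => simp only [map_add, hx, hy]
  | single σ x =>
    induction x using EnvAlg.induction with
    | hof a b => rw [ofSkew_single, toSkewₗ_of]
    | hadd x y hx hy => simp only [SkewMonoidAlgebra.single_add, map_add, hx, hy]

variable (k Γ A) in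
/-- The isomorphism `(A, Γ)ᵉ ≅ Aᵉ ⋆ Γ`. -/
def equivSkew : EquivEnv k Γ A ≃ₐ[k] SkewEnv k Γ A :=
  AlgEquiv.ofLinearEquiv
    { toSkewₗ k Γ A with
      invFun := ofSkew k Γ A
      left_inv := ofSkew_toSkewₗ
      right_inv := toSkewₗ_ofSkew }
    (toSkewₗ_of 1 1 1) toSkewₗ_mul

lemma equivSkew_of (a : A) (σ : Γ) (b : A) :
    equivSkew k Γ A (of k a σ b) = SkewMonoidAlgebra.single σ (EnvAlg.of k a b) := toSkewₗ_of a σ b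

end EquivEnv

end Skew

/-! ### Averaging over the group -/

section Separable

variable {k : Type u} [Field k] {Γ : Type uG} [Group Γ] [Finite Γ]

/-- If the group algebra of a finite group is separable, then the order of the group is
invertible. -/
lemma IsSeparableAlgebra.natCard_ne_zero (h : IsSeparableAlgebra k (MonoidAlgebra k Γ)) :
    (Nat.card Γ : k) ≠ 0 := by
  obtain ⟨e, he, hb⟩ := h
  let aug : MonoidAlgebra k Γ →ₐ[k] k := MonoidAlgebra.lift k k Γ 1
  have haug : ∀ σ : Γ, aug (MonoidAlgebra.single σ 1) = 1 := fun σ => by simp [aug]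
  -- `p` is `id ⊗ aug`. It sends the separability idempotent to an element invariant under left
  -- translation, so one with constant coefficients; its augmentation is `1` and also the order of
  -- `Γ` times that constant.
  let p : MonoidAlgebra k Γ ⊗[k] MonoidAlgebra k Γ →ₐ[k] MonoidAlgebra k Γ :=
    Algebra.TensorProduct.lift (AlgHom.id k _) ((Algebra.ofId k _).comp aug)
      fun x c => (Algebra.commutes (aug c) x).symm
  have hpt : ∀ x y, p (x ⊗ₜ y) = aug y • x := fun x y => by
    rw [Algebra.smul_def, Algebra.commutes]
    exact Algebra.TensorProduct.lift_tmul _ _ _ _ _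
  have hp : ∀ σ : Γ, MonoidAlgebra.single σ 1 * p e = p e := by
    intro σ
    have := congrArg p (hb (MonoidAlgebra.single σ 1))
    simpa only [map_mul, hpt, haug, map_one, one_smul, mul_one] using this
  have hp' : ∀ x : MonoidAlgebra k Γ ⊗[k] MonoidAlgebra k Γ,
      aug (p x) = aug (LinearMap.mul' k (MonoidAlgebra k Γ) x) := by
    intro x
    induction x using TensorProduct.induction_on with
    | zero => simp
    | add x y hx hy => simp only [map_add, hx, hy]
    | tmul x y => rw [hpt, map_smul, LinearMap.mul'_apply, map_mul, smul_eq_mul, mul_comm]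
  have hcoeff : ∀ σ : Γ, (p e).coeff σ = (p e).coeff 1 := fun σ => by
    have := congrArg (fun x : MonoidAlgebra k Γ => x.coeff σ) (hp σ)
    simpa [MonoidAlgebra.coeff_single_mul_apply] using this.symm
  intro h0
  have h1 : aug (p e) = 1 := by rw [hp', he, map_one]
  cases nonempty_fintype Γ
  rw [Nat.card_eq_fintype_card] at h0
  have h2 : aug (p e) = ∑ σ : Γ, (p e).coeff σ := by
    simp [aug, MonoidAlgebra.lift_apply, Finsupp.sum_fintype]
  rw [h2] at h1
  simp [hcoeff, h0] at h1

end Separable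

noncomputable section Averaging

variable (k : Type u) [Field k] (A : Type uA) [Ring A] [Algebra k A] (M : Type uM)
  [AddCommGroup M] [Module k M] [Module A M] [Module Aᵐᵒᵖ M]
  [SMulCommClass A Aᵐᵒᵖ M] [IsScalarTower k A M] [IsScalarTower k Aᵐᵒᵖ M]
  (Γ : Type uG) [Group Γ] [MulSemiringAction Γ A] [SMulCommClass Γ k A]
  [DistribMulAction Γ M] [SMulCommClass Γ k M] [IsEquivariantBimodule Γ A M]

variable {k A M Γ}

lemma cochainAct_apply {n : ℕ} (σ : Γ) (φ : HochCochain k A M n) (a : Fin n → A) :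
    cochainAct k A M n σ φ a = σ • φ fun i => σ⁻¹ • a i := rfl

lemma cochainAct_mul {n : ℕ} (σ τ : Γ) (φ : HochCochain k A M n) :
    cochainAct k A M n (σ * τ) φ = cochainAct k A M n σ (cochainAct k A M n τ φ) := by
  ext a
  simp [cochainAct_apply, mul_smul]

lemma mem_equivariantCochains_iff {n : ℕ} {φ : HochCochain k A M n} :
    φ ∈ equivariantCochains k A M Γ n ↔ ∀ σ : Γ, cochainAct k A M n σ φ = φ := by
  refine ⟨cochainAct_of_mem Γ n φ, fun h σ a => ?_⟩
  have := congrArg (fun ψ => ψ fun i => σ • a i) (h σ)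
  simpa [cochainAct_apply] using this.symm

/-- `Γ` acts on the Hochschild complex by chain maps, because it respects the product of `A` and
both actions on `M`; hence norms are compatible with the differential. -/
lemma cochainAct_hochDiff {n : ℕ} (σ : Γ) (φ : HochCochain k A M n) :
    cochainAct k A M (n + 1) σ (hochDiff k A M n φ) =
      hochDiff k A M n (cochainAct k A M n σ φ) := by
  ext a
  have h : ∀ j : Fin n, Fin.contractNth j.castSucc (· * ·) (fun i => σ⁻¹ • a i) =
      fun i => σ⁻¹ • Fin.contractNth j.castSucc (· * ·) a i := fun j =>
    (Fin.comp_contractNth (· * ·) (· * ·) (f := fun x : A => σ⁻¹ • x)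
      (fun x y => smul_mul' σ⁻¹ x y) j.castSucc a).symm
  rw [cochainAct_apply, hochDiff_apply, hochDiff_apply]
  simp only [h, cochainAct_apply, smul_add, Finset.smul_sum, IsEquivariantBimodule.smul_left,
    IsEquivariantBimodule.smul_right, smul_inv_smul, smul_comm σ (_ : k)]

variable [Fintype Γ]

variable (k A M Γ) in
/-- The sum of the translates of a cochain by the elements of `Γ`. -/
def cochainNorm (n : ℕ) : HochCochain k A M n →ₗ[k] equivariantCochains k A M Γ n where
  toFun φ := ⟨∑ τ : Γ, cochainAct k A M n τ φ, mem_equivariantCochains_iff.2 fun σ => by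
    rw [map_sum]
    simp only [← cochainAct_mul]
    exact Equiv.sum_comp (Equiv.mulLeft σ) fun τ => cochainAct k A M n τ φ⟩
  map_add' φ ψ := Subtype.ext (by simp [Finset.sum_add_distrib])
  map_smul' c φ := Subtype.ext (by simp [Finset.smul_sum])

lemma coe_cochainNorm (n : ℕ) (φ : HochCochain k A M n) :
    (cochainNorm k A M Γ n φ : HochCochain k A M n) = ∑ τ : Γ, cochainAct k A M n τ φ := rfl

lemma cochainNorm_of_mem (n : ℕ) (φ : equivariantCochains k A M Γ n) :
    cochainNorm k A M Γ n φ = (Nat.card Γ : k) • φ := by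
  refine Subtype.ext ?_
  rw [coe_cochainNorm]
  simp [cochainAct_of_mem Γ n φ.1 φ.2, Nat.cast_smul_eq_nsmul]

lemma cochainNorm_hochDiff (n : ℕ) (φ : HochCochain k A M n) :
    cochainNorm k A M Γ (n + 1) (hochDiff k A M n φ) =
      equivariantDiff k A M Γ n (cochainNorm k A M Γ n φ) := by
  refine Subtype.ext ?_
  change _ = hochDiff k A M n (cochainNorm k A M Γ n φ : HochCochain k A M n)
  simp only [coe_cochainNorm, cochainAct_hochDiff, map_sum]

variable (k A M Γ) in
/-- Summation over the last group variable. -/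
def sumLast (p q : ℕ) : BiCochain k A M Γ (p + 1) q →ₗ[k] BiCochain k A M Γ p q where
  toFun f g := ∑ τ : Γ, f (Fin.snoc g τ)
  map_add' f f' := by funext g; simp [Finset.sum_add_distrib]
  map_smul' c f := by funext g; simp [Finset.smul_sum]

lemma sumLast_apply {p q : ℕ} (f : BiCochain k A M Γ (p + 1) q) (g : Fin p → Γ) :
    sumLast k A M Γ p q f g = ∑ τ : Γ, f (Fin.snoc g τ) := rfl

lemma groupDiff_apply {p q : ℕ} (f : BiCochain k A M Γ p q) (g : Fin (p + 1) → Γ) :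
    groupDiff k A M Γ p q f g = cochainAct k A M q (g 0) (f fun i => g i.succ) +
      ∑ j : Fin p, (-1 : k) ^ ((j : ℕ) + 1) • f (Fin.contractNth j.castSucc (· * ·) g) +
      (-1 : k) ^ (p + 1) • f (fun i => g i.castSucc) := rfl

lemma sumLast_hochDirDiff {p q : ℕ} (f : BiCochain k A M Γ (p + 1) q) :
    sumLast k A M Γ p (q + 1) (hochDirDiff k A M Γ (p + 1) q f) =
      hochDirDiff k A M Γ p q (sumLast k A M Γ p q f) := by
  funext g
  exact (map_sum (hochDiff k A M q) (fun τ => f (Fin.snoc g τ)) Finset.univ).symm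

lemma contractNth_castSucc_snoc {p : ℕ} (g : Fin (p + 1) → Γ) (τ : Γ) (j : Fin p) :
    Fin.contractNth j.castSucc.castSucc (· * ·) (Fin.snoc g τ : Fin (p + 2) → Γ) =
      Fin.snoc (Fin.contractNth j.castSucc (· * ·) g) τ := by
  funext i
  refine Fin.lastCases ?_ (fun i => ?_) i
  · rw [Fin.contractNth_apply_of_gt _ _ _ _ (by simp), Fin.succ_last, Fin.snoc_last, Fin.snoc_last]
  · rw [Fin.snoc_castSucc]
    simp only [Fin.contractNth, Fin.val_castSucc, Fin.snoc_castSucc, ← Fin.castSucc_succ]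

/-- This is the only contraction that changes the summed variable: it translates `τ`, which a sum
over the whole group does not see. -/
lemma contractNth_last_snoc {p : ℕ} (g : Fin (p + 1) → Γ) (τ : Γ) :
    Fin.contractNth (Fin.last p).castSucc (· * ·) (Fin.snoc g τ : Fin (p + 2) → Γ) =
      Fin.snoc (fun i => g i.castSucc) (g (Fin.last p) * τ) := by
  funext i
  refine Fin.lastCases ?_ (fun i => ?_) i
  · rw [Fin.contractNth_apply_of_eq _ _ _ _ (by simp), Fin.succ_last, Fin.snoc_last, Fin.snoc_last,
      Fin.snoc_castSucc]
  · rw [Fin.contractNth_apply_of_lt _ _ _ _ (by simp), Fin.snoc_castSucc, Fin.snoc_castSucc]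

/-- Summation over the last variable commutes with the group differential up to a multiple of the
identity. -/
lemma sumLast_groupDiff {p q : ℕ} (f : BiCochain k A M Γ (p + 1) q) :
    sumLast k A M Γ (p + 1) q (groupDiff k A M Γ (p + 1) q f) =
      groupDiff k A M Γ p q (sumLast k A M Γ p q f) +
        ((-1 : k) ^ (p + 2) * (Nat.card Γ : k)) • f := by
  funext g
  have h0 : ∀ τ, (Fin.snoc g τ : Fin (p + 2) → Γ) 0 = g 0 := fun τ =>
    Fin.snoc_castSucc (α := fun _ => Γ) τ g 0
  have hsucc : ∀ τ, (fun i : Fin (p + 1) => (Fin.snoc g τ : Fin (p + 2) → Γ) i.succ) =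
      Fin.snoc (fun i => g i.succ) τ := by
    intro τ
    funext i
    refine Fin.lastCases ?_ (fun i => ?_) i
    · rw [Fin.succ_last, Fin.snoc_last, Fin.snoc_last]
    · rw [← Fin.castSucc_succ, Fin.snoc_castSucc, Fin.snoc_castSucc]
  -- After reindexing, the last contraction supplies the omission term of the differential in degree
  -- `p`, with the right sign `(-1) ^ (p + 1)`. The omission term in degree `p + 1` drops `τ`, so
  -- its sum is the multiple of `f`.
  have hlast : ∑ τ : Γ, f (Fin.snoc (fun i => g i.castSucc) (g (Fin.last p) * τ)) =
      ∑ τ : Γ, f (Fin.snoc (fun i => g i.castSucc) τ) :=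
    Equiv.sum_comp (Equiv.mulLeft (g (Fin.last p))) fun τ => f (Fin.snoc (fun i => g i.castSucc) τ)
  rw [sumLast_apply, Pi.add_apply, groupDiff_apply, Pi.smul_apply]
  simp only [groupDiff_apply, h0, hsucc, Fin.sum_univ_castSucc, contractNth_castSucc_snoc,
    contractNth_last_snoc, Fin.snoc_castSucc, Finset.sum_add_distrib, Fin.val_castSucc,
    Fin.val_last, sumLast_apply, map_sum, Finset.smul_sum, ← hlast]
  rw [Finset.sum_comm]
  simp only [Finset.sum_const, Finset.card_univ, Nat.card_eq_fintype_card, mul_comm _ (_ : k),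
    mul_smul, Nat.cast_smul_eq_nsmul]
  abel

/-- Here the differential is `τ ↦ τ f - f`. The norm term is the defect of the row contraction in
the column `p = 0`, where the invariants survive. -/
lemma sumLast_groupDiff_zero {q : ℕ} (f : BiCochain k A M Γ 0 q) (g : Fin 0 → Γ) :
    sumLast k A M Γ 0 q (groupDiff k A M Γ 0 q f) g =
      (cochainNorm k A M Γ q (f g) : HochCochain k A M q) - (Nat.card Γ : k) • f g := by
  rw [sumLast_apply, coe_cochainNorm]
  have hf : ∀ g' : Fin 0 → Γ, f g' = f g := fun g' => congrArg f (Subsingleton.elim _ _)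
  have h0 : ∀ τ, (Fin.snoc g τ : Fin 1 → Γ) 0 = τ := fun τ => Fin.snoc_last (α := fun _ => Γ) τ g
  simp only [groupDiff_apply, hf, h0, Finset.univ_eq_empty, Finset.sum_empty, add_zero, zero_add,
    pow_one, neg_smul, one_smul, Finset.sum_add_distrib, Finset.sum_neg_distrib, Finset.sum_const,
    Finset.card_univ, Nat.card_eq_fintype_card, Nat.cast_smul_eq_nsmul, sub_eq_add_neg]

end Averaging

/-! ### The comparison map in the separable case -/

noncomputable section Comparison

variable (k : Type u) [Field k] (A : Type uA) [Ring A] [Algebra k A] (M : Type uM)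
  [AddCommGroup M] [Module k M] [Module A M] [Module Aᵐᵒᵖ M]
  [SMulCommClass A Aᵐᵒᵖ M] [IsScalarTower k A M] [IsScalarTower k Aᵐᵒᵖ M]
  (Γ : Type uG) [Group Γ] [MulSemiringAction Γ A] [SMulCommClass Γ k A]
  [DistribMulAction Γ M] [SMulCommClass Γ k M] [IsEquivariantBimodule Γ A M] [Fintype Γ]

/-- The contracting homotopy of the rows of the bicomplex, on the total complex. -/
def totHomotopy (n : ℕ) : TotCochain k A M Γ (n + 1) →ₗ[k] TotCochain k A M Γ n :=
  -- The scalar one column further cancels the factor `(-1) ^ (p + 2) * |Γ|` of `sumLast_groupDiff`.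
  -- Its alternation in `p` makes the group-differential terms cancel.
  LinearMap.pi fun x => ((-1 : k) ^ (x.1.1 + 1) * (Nat.card Γ : k)⁻¹) •
    (sumLast k A M Γ x.1.1 x.1.2 ∘ₗ LinearMap.proj
      (⟨(x.1.1 + 1, x.1.2), congrArg (· + 1) x.2⟩ : Bidegree (n + 1)))

/-- Averaging over `Γ` in the column `p = 0`, a retraction of the edge inclusion. -/
def totAverage (n : ℕ) : TotCochain k A M Γ n →ₗ[k] equivariantCochains k A M Γ n :=
  (Nat.card Γ : k)⁻¹ • (cochainNorm k A M Γ n ∘ₗ LinearMap.proj Fin.elim0 ∘ₗ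
    LinearMap.proj (⟨(0, n), rfl⟩ : Bidegree n))

variable {k A M Γ}

lemma totHomotopy_apply {n : ℕ} (f : TotCochain k A M Γ (n + 1)) (p q : ℕ) (h : q + p = n) :
    totHomotopy k A M Γ n f ⟨(p, q), h⟩ = ((-1 : k) ^ (p + 1) * (Nat.card Γ : k)⁻¹) •
      sumLast k A M Γ p q (f ⟨(p + 1, q), congrArg (· + 1) h⟩) := rfl

lemma totAverage_apply {n : ℕ} (f : TotCochain k A M Γ n) :
    totAverage k A M Γ n f =
      (Nat.card Γ : k)⁻¹ • cochainNorm k A M Γ n (f ⟨(0, n), rfl⟩ Fin.elim0) := rfl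

lemma totDiff_apply {n : ℕ} (f : TotCochain k A M Γ n) (x : Bidegree (n + 1)) :
    totDiff k A M Γ n f x = totGroup k A M Γ n x f + totHoch k A M Γ n x f := rfl

/-- Nothing arrives in the column `p = 0` from the group direction, and the Hochschild sign there is
`+1`. -/
lemma totAverage_totDiff (n : ℕ) (f : TotCochain k A M Γ n) :
    totAverage k A M Γ (n + 1) (totDiff k A M Γ n f) =
      equivariantDiff k A M Γ n (totAverage k A M Γ n f) := by
  rw [totAverage_apply, totAverage_apply, map_smul, ← cochainNorm_hochDiff, totDiff_apply]
  congr 2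
  simp [totGroup, totHoch, hochDirDiff]

lemma edge_zero (n : ℕ) (φ : equivariantCochains k A M Γ n) :
    edge k A M Γ n φ ⟨(0, n), rfl⟩ = fun _ => φ.1 := rfl

lemma edge_succ (n p q : ℕ) (h : q + (p + 1) = n) (φ : equivariantCochains k A M Γ n) :
    edge k A M Γ n φ ⟨(p + 1, q), h⟩ = 0 := rfl

variable (hΓ : (Nat.card Γ : k) ≠ 0)
include hΓ

lemma totAverage_edge (n : ℕ) (φ : equivariantCochains k A M Γ n) :
    totAverage k A M Γ n (edge k A M Γ n φ) = φ := by
  rw [totAverage_apply, edge_zero, cochainNorm_of_mem, smul_smul, inv_mul_cancel₀ hΓ, one_smul]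

lemma edge_totAverage_zero {n : ℕ} (f : TotCochain k A M Γ n) :
    (-1 * (Nat.card Γ : k)⁻¹) • sumLast k A M Γ 0 n (groupDiff k A M Γ 0 n (f ⟨(0, n), rfl⟩)) =
      f ⟨(0, n), rfl⟩ - edge k A M Γ n (totAverage k A M Γ n f) ⟨(0, n), rfl⟩ := by
  funext g
  rw [Pi.smul_apply, sumLast_groupDiff_zero, Pi.sub_apply, edge_zero, totAverage_apply,
    Submodule.coe_smul, Subsingleton.elim Fin.elim0 g, neg_one_mul, neg_smul, smul_sub, smul_smul,
    inv_mul_cancel₀ hΓ, one_smul, neg_sub]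

lemma groupHomotopy_succ {p q : ℕ} (f : BiCochain k A M Γ (p + 1) q) :
    ((-1 : k) ^ (p + 2) * (Nat.card Γ : k)⁻¹) •
        sumLast k A M Γ (p + 1) q (groupDiff k A M Γ (p + 1) q f) +
      groupDiff k A M Γ p q (((-1 : k) ^ (p + 1) * (Nat.card Γ : k)⁻¹) • sumLast k A M Γ p q f) =
      f := by
  have h : (-1 : k) ^ (p + 2) * (Nat.card Γ : k)⁻¹ * ((-1 : k) ^ (p + 2) * (Nat.card Γ : k)) = 1 := by
    rw [mul_mul_mul_comm, inv_mul_cancel₀ hΓ, ← mul_pow]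
    simp
  rw [sumLast_groupDiff, smul_add, smul_smul, h, one_smul, map_smul, pow_succ _ (p + 1)]
  simp

lemma totHomotopy_totDiff_zero (f : TotCochain k A M Γ 0) :
    totHomotopy k A M Γ 0 (totDiff k A M Γ 0 f) =
      f - edge k A M Γ 0 (totAverage k A M Γ 0 f) := by
  funext ⟨⟨p, q⟩, h⟩
  obtain rfl : p = 0 := by simp only at h; omega
  obtain rfl : q = 0 := h
  rw [totHomotopy_apply, totDiff_apply]
  refine Eq.trans ?_ (edge_totAverage_zero hΓ f)
  simp [totGroup, totHoch]

/-- The two directions separate: the Hochschild terms cancel (`hH`), and the group terms are the row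
contraction (`hG`), equal to the identity for `p > 0` and to the identity minus the average for `p =
0`. -/
lemma totHomotopy_totDiff_succ (n : ℕ) (f : TotCochain k A M Γ (n + 1)) :
    totHomotopy k A M Γ (n + 1) (totDiff k A M Γ (n + 1) f) +
      totDiff k A M Γ n (totHomotopy k A M Γ n f) =
      f - edge k A M Γ (n + 1) (totAverage k A M Γ (n + 1) f) := by
  funext ⟨⟨p, q⟩, h⟩
  have hH : ((-1 : k) ^ (p + 1) * (Nat.card Γ : k)⁻¹) • sumLast k A M Γ p q
      (totHoch k A M Γ (n + 1) ⟨(p + 1, q), congrArg (· + 1) h⟩ f) +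
      totHoch k A M Γ n ⟨(p, q), h⟩ (totHomotopy k A M Γ n f) = 0 := by
    rcases q with _ | q
    · simp [totHoch]
    · simp only [totHoch, LinearMap.smul_apply, LinearMap.comp_apply, LinearMap.proj_apply,
        totHomotopy_apply, map_smul, sumLast_hochDirDiff, smul_smul, ← add_smul]
      -- The sign `(-1) ^ p` of the Hochschild differential changes between the adjacent columns
      -- joined by the homotopy.
      rw [show (-1 : k) ^ (p + 1) * (Nat.card Γ : k)⁻¹ * (-1) ^ (p + 1) +
        (-1) ^ p * ((-1) ^ (p + 1) * (Nat.card Γ : k)⁻¹) = 0 by ring, zero_smul]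
  have hG : ((-1 : k) ^ (p + 1) * (Nat.card Γ : k)⁻¹) • sumLast k A M Γ p q
      (totGroup k A M Γ (n + 1) ⟨(p + 1, q), congrArg (· + 1) h⟩ f) +
      totGroup k A M Γ n ⟨(p, q), h⟩ (totHomotopy k A M Γ n f) =
      f ⟨(p, q), h⟩ - edge k A M Γ (n + 1) (totAverage k A M Γ (n + 1) f) ⟨(p, q), h⟩ := by
    rcases p with _ | p
    · obtain rfl : q = n + 1 := h
      refine Eq.trans ?_ (edge_totAverage_zero hΓ f)
      simp [totGroup]
    · rw [edge_succ, sub_zero]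
      exact groupHomotopy_succ hΓ (f ⟨(p + 1, q), h⟩)
  simp only [Pi.add_apply, Pi.sub_apply, totHomotopy_apply, totDiff_apply, map_add, smul_add]
  rw [add_add_add_comm, hG, hH, add_zero]

/-- The comparison map is bijective if the order of the group is invertible. -/
lemma comparison_bijective (n : ℕ) : Function.Bijective (comparison k A M Γ n) := by
  refine Cohomology.map_bijective _ _ (totAverage k A M Γ) totAverage_totDiff n
    (fun φ _ => ?_) (fun f hf => ?_)
  · rw [totAverage_edge hΓ, sub_self]
    exact Submodule.zero_mem _
  · rw [← Submodule.neg_mem_iff, neg_sub]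
    -- In degree `0` every coboundary is zero, so the one-term homotopy identity must give equality
    -- there.
    cases n with
    | zero =>
      rw [← totHomotopy_totDiff_zero hΓ, hf, map_zero]
      exact Submodule.zero_mem _
    | succ n =>
      rw [← totHomotopy_totDiff_succ hΓ, hf, map_zero, zero_add]
      exact ⟨_, rfl⟩

end Comparison

/-! ### Naturality of the comparison map -/

section Naturality

variable {k : Type u} [Field k] {Γ : Type uG} [Group Γ]
  {A : Type uA} [Ring A] [Algebra k A] [MulSemiringAction Γ A] [SMulCommClass Γ k A]
  {M : Type uM} [AddCommGroup M] [Module k M] [Module A M] [Module Aᵐᵒᵖ M]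
  [SMulCommClass A Aᵐᵒᵖ M] [IsScalarTower k A M] [IsScalarTower k Aᵐᵒᵖ M]
  [DistribMulAction Γ M] [SMulCommClass Γ k M] [IsEquivariantBimodule Γ A M]
  {A' : Type uA'} [Ring A'] [Algebra k A'] [MulSemiringAction Γ A'] [SMulCommClass Γ k A']
  {M' : Type uM'} [AddCommGroup M'] [Module k M'] [Module A' M'] [Module A'ᵐᵒᵖ M']
  [SMulCommClass A' A'ᵐᵒᵖ M'] [IsScalarTower k A' M'] [IsScalarTower k A'ᵐᵒᵖ M']
  [DistribMulAction Γ M'] [SMulCommClass Γ k M'] [IsEquivariantBimodule Γ A' M']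

lemma EquivariantPairHom.tot_edge (F : EquivariantPairHom k Γ A M A' M') (n : ℕ)
    (φ : equivariantCochains k A M Γ n) :
    edge k A' M' Γ n ((F.cochain n).restrict (F.cochain_mem n) φ) =
      F.tot n (edge k A M Γ n φ) := by
  funext ⟨⟨p, q⟩, h⟩
  rcases p with _ | p
  · obtain rfl : q = n := h
    rfl
  · funext g
    exact (map_zero (F.cochain q)).symm

/-- The comparison map is natural. -/
lemma comparison_natural (F : EquivariantPairHom k Γ A M A' M') (n : ℕ) :
    comparison k A' M' Γ n ∘ₗ F.mapHH n = F.mapKP n ∘ₗ comparison k A M Γ n := by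
  rw [comparison, comparison, EquivariantPairHom.mapHH, EquivariantPairHom.mapKP,
    Cohomology.map_comp, Cohomology.map_comp]
  congr 1
  funext n
  exact LinearMap.ext (F.tot_edge n)

end Naturality

theorem theorem1p2
    (k : Type u) [Field k] (Γ : Type uG) [Group Γ] [Finite Γ]
    (A : Type uA) [Ring A] [Algebra k A] [MulSemiringAction Γ A] [SMulCommClass Γ k A]
    (M : Type uM) [AddCommGroup M] [Module k M] [Module A M] [Module Aᵐᵒᵖ M]
    [SMulCommClass A Aᵐᵒᵖ M] [IsScalarTower k A M] [IsScalarTower k Aᵐᵒᵖ M]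
    [DistribMulAction Γ M] [SMulCommClass Γ k M] [IsEquivariantBimodule Γ A M] (n : ℕ) :
    -- `(A, Γ)ᵉ ≅ Aᵉ ⋆ Γ`
    (∃ e : EquivEnv k Γ A ≃ₐ[k] SkewEnv k Γ A, ∀ (a : A) (σ : Γ) (b : A),
      e (EquivEnv.of k a σ b) = SkewMonoidAlgebra.single σ (EnvAlg.of k a b)) ∧
    -- part (i); the relative `Ext` may be computed with any relative projective resolution
    Nonempty (RelProjResolution.{u, max u uG uA, uA, max u uA}
      (EquivEnv.groupSubalgebra k Γ A) A) ∧
    (∀ P : RelProjResolution.{u, max u uG uA, uA, w} (EquivEnv.groupSubalgebra k Γ A) A,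
      Nonempty (EquivariantHH k A M Γ n ≃ₗ[k] RelExt P M n)) ∧
    -- part (ii), the map is natural
    (∀ (A' : Type uA') [Ring A'] [Algebra k A'] [MulSemiringAction Γ A'] [SMulCommClass Γ k A']
      (M' : Type uM') [AddCommGroup M'] [Module k M'] [Module A' M'] [Module A'ᵐᵒᵖ M']
      [SMulCommClass A' A'ᵐᵒᵖ M'] [IsScalarTower k A' M'] [IsScalarTower k A'ᵐᵒᵖ M']
      [DistribMulAction Γ M'] [SMulCommClass Γ k M'] [IsEquivariantBimodule Γ A' M']
      (F : EquivariantPairHom k Γ A M A' M'),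
      comparison k A' M' Γ n ∘ₗ F.mapHH n = F.mapKP n ∘ₗ comparison k A M Γ n) ∧
    -- part (ii), the map is an isomorphism in the separable case
    (IsSeparableAlgebra k (MonoidAlgebra k Γ) → Function.Bijective (comparison k A M Γ n)) := by
  refine ⟨⟨EquivEnv.equivSkew k Γ A, EquivEnv.equivSkew_of⟩, ⟨Bar.resolution k Γ A⟩, fun P => ?_,
    fun A' _ _ _ _ M' _ _ _ _ _ _ _ _ _ _ F => comparison_natural F n, fun h => ?_⟩
  · obtain ⟨e⟩ := Bar.nonempty_equivariantHH_equiv (k := k) (Γ := Γ) (A := A) M n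
    obtain ⟨e'⟩ := RelProjResolution.nonempty_relExt_equiv.{u, uG, uA, uM, max u uA, w} M
      (Bar.resolution k Γ A)
      (fun _ L N => InducedBimodule.relLifts L N) (fun L => InducedBimodule.relLifts L A) P n
    exact ⟨e.trans e'⟩
  · cases nonempty_fintype Γ
    exact comparison_bijective h.natCard_ne_zero n
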